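/- Let $n\ge 1$ and let $\mathcal E_n$ be the $\mathbb R$-algebra of germs at $0$ of real $C^\infty$ functions on $\mathbb R^n$. For $f\in\mathcal E_n$ let $J(f)\subset\mathcal E_n$ be the ideal generated by $\partial f/\partial x_1,\dots,\partial f/\partial x_n$, let $\mu(f)=\dim_{\mathbb R}\mathcal E_n/J(f)\in\mathbb N\cup\{\infty\}$ be the real Milnor number of $f$, and say that $f$ has an algebraically isolated singularity at the origin if $\mu(f)<\infty$. For $f\in\mathcal E_n$ with $f(0)=0$, the order $\operatorname{ord}(f)$ is the real number $\alpha\ge 0$ such that $\lim_{t\to0^+} f(tv)/t^\alpha$ exists for every $v\in\mathbb R^n\setminus\{0\}$ and is nonzero for at least one such $v$ (and $\operatorname{ord}(f)=\infty$ if there is no such $\alpha$). The initial part $\operatorname{in}(f)$ of $f$, if it exists, is the positively homogeneous function $f_\alpha$ of some degree $\alpha\ge0$ such that $f_\alpha(x)/\|x\|^\alpha\not\to0$ and $(f(x)-f_\alpha(x))/\|x\|^\alpha\to0$ as $x\to0$. Let $f\colon(\mathbb R^n,0)\to(\mathbb R,0)$ be a germ of a $C^\infty$ function that has an initial part $\operatorname{in}(f)$.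 If $\operatorname{in}(f)$ has an algebraically isolated singularity at the origin, then $\operatorname{ord}(f)$ is a positive integer and $$\mu(f)=(\operatorname{ord}(f)-1)^n .$$ -/

import Mathlib

open Filter Topology
open scoped ContDiff NNReal ENNReal

noncomputable section

namespace RealMilnor

/-- The Euclidean space `ℝⁿ`. -/
abbrev Eucl (n : ℕ) : Type := EuclideanSpace ℝ (Fin n)

/-- The `ℝ`-algebra of all function germs `(ℝⁿ, 0) → ℝ`; the scalars act by multiplication. -/
instance germAlgebra (n : ℕ) : Algebra ℝ (Germ (𝓝 (0 : Eucl n)) ℝ) :=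
  Algebra.ofModule
    (fun r x y => by
      induction x using Germ.inductionOn with | _ f =>
      induction y using Germ.inductionOn with | _ g =>
      exact congrArg _ (smul_mul_assoc r f g))
    (fun r x y => by
      induction x using Germ.inductionOn with | _ f =>
      induction y using Germ.inductionOn with | _ g =>
      exact congrArg _ (mul_smul_comm r f g))

/-- `F` is of class `C^∞` on some neighbourhood of the origin (one neighbourhood for all orders of
differentiation). -/
def SmoothNearZero {n : ℕ} (F : Eucl n → ℝ) : Prop :=
  ∃ U : Set (Eucl n), IsOpen U ∧ (0 : Eucl n) ∈ U ∧ ContDiffOn ℝ ∞ F U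

/-- `𝓔ₙ`: the `ℝ`-algebra of germs at the origin of real `C^∞` functions on `ℝⁿ`. -/
def SmoothGerm (n : ℕ) : Subalgebra ℝ (Germ (𝓝 (0 : Eucl n)) ℝ) where
  carrier := {φ | ∃ F : Eucl n → ℝ, SmoothNearZero F ∧ (F : Germ (𝓝 (0 : Eucl n)) ℝ) = φ}
  mul_mem' := by
    rintro _ _ ⟨F, ⟨U, hU, h0, hF⟩, rfl⟩ ⟨G, ⟨V, hV, h0', hG⟩, rfl⟩
    exact ⟨F * G, ⟨U ∩ V, hU.inter hV, ⟨h0, h0'⟩,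
      (hF.mono Set.inter_subset_left).mul (hG.mono Set.inter_subset_right)⟩, rfl⟩
  add_mem' := by
    rintro _ _ ⟨F, ⟨U, hU, h0, hF⟩, rfl⟩ ⟨G, ⟨V, hV, h0', hG⟩, rfl⟩
    exact ⟨F + G, ⟨U ∩ V, hU.inter hV, ⟨h0, h0'⟩,
      (hF.mono Set.inter_subset_left).add (hG.mono Set.inter_subset_right)⟩, rfl⟩
  algebraMap_mem' := by
    intro r
    refine ⟨r • (1 : Eucl n → ℝ), ⟨Set.univ, isOpen_univ, trivial, ?_⟩, ?_⟩
    · exact contDiffOn_const (𝕜 := ℝ) (c := r • (1 : ℝ))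
    · rw [Algebra.algebraMap_eq_smul_one]
      rfl

/-- The `i`-th partial derivative of a function on `ℝⁿ`. -/
def partialFun {n : ℕ} (i : Fin n) (F : Eucl n → ℝ) : Eucl n → ℝ :=
  fun x => fderiv ℝ F x (EuclideanSpace.single i 1)

/-- The `i`-th partial derivative of a germ. -/
def partialGerm {n : ℕ} (i : Fin n) (φ : Germ (𝓝 (0 : Eucl n)) ℝ) : Germ (𝓝 (0 : Eucl n)) ℝ :=
  Germ.map' (partialFun i)
    (fun F G h => by
      filter_upwards [h.fderiv (𝕜 := ℝ)] with x hx
      simp only [partialFun, hx]) φ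

theorem partialGerm_mem {n : ℕ} (i : Fin n) {φ : Germ (𝓝 (0 : Eucl n)) ℝ}
    (hφ : φ ∈ SmoothGerm n) : partialGerm i φ ∈ SmoothGerm n := by
  obtain ⟨F, ⟨U, hU, h0, hF⟩, rfl⟩ := hφ
  exact ⟨partialFun i F, ⟨U, hU, h0,
    (hF.fderiv_of_isOpen hU (by simp)).clm_apply contDiffOn_const⟩, rfl⟩

/-- `∂f/∂xᵢ ∈ 𝓔ₙ` for `f ∈ 𝓔ₙ`. -/
def partialDeriv {n : ℕ} (i : Fin n) (f : SmoothGerm n) : SmoothGerm n :=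
  ⟨partialGerm i f.1, partialGerm_mem i f.2⟩

/-- The Jacobian ideal `J(f)` of `𝓔ₙ`, generated by the partial derivatives of `f`. -/
def jacobianIdeal {n : ℕ} (f : SmoothGerm n) : Ideal (SmoothGerm n) :=
  Ideal.span (Set.range fun i : Fin n => partialDeriv i f)

/-- The real Milnor number `μ(f) = dim_ℝ 𝓔ₙ / J(f)`, which is `⊤` if the dimension is infinite. -/
def milnorNumber {n : ℕ} (f : SmoothGerm n) : ℕ∞ :=
  Cardinal.toENat (Module.rank ℝ (SmoothGerm n ⧸ jacobianIdeal f))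

/-- `f` has an algebraically isolated singularity at the origin: `μ(f) < ∞`. -/
def AlgebraicallyIsolated {n : ℕ} (f : SmoothGerm n) : Prop :=
  milnorNumber f < ⊤

/-- `F` has finite order `α` at the origin: `F(tv) / t^α` has a limit as `t → 0⁺` for every
`v ≠ 0`, and the limit is nonzero for at least one `v ≠ 0`. -/
def HasOrder {n : ℕ} (F : Eucl n → ℝ) (α : ℝ≥0) : Prop :=
  (∀ v : Eucl n, v ≠ 0 → ∃ L : ℝ, Tendsto (fun t : ℝ => F (t • v) / t ^ (α : ℝ)) (𝓝[>] 0) (𝓝 L)) ∧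
  ∃ v : Eucl n, v ≠ 0 ∧
    ∃ L : ℝ, L ≠ 0 ∧ Tendsto (fun t : ℝ => F (t • v) / t ^ (α : ℝ)) (𝓝[>] 0) (𝓝 L)

open Classical in
/-- The order at the origin of a smooth germ: `0` if `f(0) ≠ 0`, otherwise the number `α` such that
a representative of `f` has order `α` (there is at most one such `α`, and it does not depend on the
representative), and `∞` if there is no such `α`, which for smooth germs means that `f` is flat. -/
def ord {n : ℕ} (f : SmoothGerm n) : ℝ≥0∞ :=
  if f.1.value ≠ 0 then 0
  else ⨅ (α : ℝ≥0) (_ : ∃ F : Eucl n → ℝ, (F : Germ (𝓝 (0 : Eucl n)) ℝ) = f.1 ∧ HasOrder F α),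
    (α : ℝ≥0∞)

/-- `g` is the initial part `in(f)` at the origin of a germ `f` with `f(0) = 0`: for some `α ≥ 0`,
`g` is (the germ of) a function `G` that is positively homogeneous of degree `α`, `G(x) / ‖x‖^α` does
not tend to `0`, and `f = G + o(‖x‖^α)`. -/
def IsInitialPart {n : ℕ} (f g : SmoothGerm n) : Prop :=
  ∃ (α : ℝ≥0) (F G : Eucl n → ℝ),
    (F : Germ (𝓝 (0 : Eucl n)) ℝ) = f.1 ∧ (G : Germ (𝓝 (0 : Eucl n)) ℝ) = g.1 ∧
    (∀ (t : ℝ) (x : Eucl n), 0 < t → G (t • x) = t ^ (α : ℝ) * G x) ∧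
    ¬ Tendsto (fun x => G x / ‖x‖ ^ (α : ℝ)) (𝓝[≠] 0) (𝓝 0) ∧
    Tendsto (fun x => (F x - G x) / ‖x‖ ^ (α : ℝ)) (𝓝[≠] 0) (𝓝 0)

end RealMilnor

end

/-! Write 𝔪 for the ideal of 𝓔ₙ generated by the coordinates. A positively homogeneous function that
is smooth at 0 is a form, so in(f) is a nonzero form P of some degree m ≥ 1, and f ≡ P mod 𝔪^(m+1)
(`IsInitialPart.exists_form`). Hence ∂f/∂xᵢ ≡ ∂P/∂xᵢ mod 𝔪^(d+1) with d = m - 1, and the claim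
becomes `IsCoordinates.finrank_quotient_eq_pow`: if forms Pᵢ of degree d generate an ideal of finite
codimension, then germs Fᵢ ≡ Pᵢ mod 𝔪^(d+1) generate an ideal of codimension d^n. Of 𝓔ₙ this uses
only `IsCoordinates`; neither Noetherianity nor convergence of Taylor series enters.

Upper bound. Finite codimension forces the polynomial ideal (Pᵢ) to contain all forms of some degree
k. Nakayama then gives 𝔪^k ⊆ (Fᵢ), and filtering by powers of 𝔪 bounds the codimension of (Fᵢ) by
the sum of the Hilbert function of ℝ[x]/(Pᵢ). The ideal of the variables has grade n, and by prime
avoidance the variables can be exchanged for a regular sequence of n linear combinations of the Pᵢ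
(`HasGrade.exists_regularSeq`). The quotient by that sequence has Hilbert series ((1 - X^d)/(1 -
X))^n, whose coefficients add up to d^n.

Lower bound, for d > 0. Let J = (Fᵢ) ⊆ 𝔪^d. The dimension of 𝓔ₙ/J^N is at least the number of
monomials of degree < dN, and at most dim 𝓔ₙ/J times the number of monomials of degree < N. As N → ∞
these numbers grow like (dN)^n/n! and N^n/n!, so d^n ≤ dim 𝓔ₙ/J. -/

noncomputable section

namespace RealMilnor

/-! ### Grade and regular sequences modulo an ideal -/

section Grade

variable {R : Type*} [CommRing R]

/-- `a` is a non-zero-divisor modulo the ideal `A`. -/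
def RegularMod (A : Ideal R) (a : R) : Prop := ∀ r, a * r ∈ A → r ∈ A

/-- The grade of `I` on `R ⧸ A` is at least `j`. -/
def HasGrade (I : Ideal R) : ℕ → Ideal R → Prop
  | 0, _ => True
  | j + 1, A => ∃ a ∈ I, RegularMod A a ∧ HasGrade I j (A ⊔ Ideal.span {a})

/-- The list is a (weakly) regular sequence on `R ⧸ A`. -/
def RegularSeq : Ideal R → List R → Prop
  | _, [] => True
  | A, a :: l => RegularMod A a ∧ RegularSeq (A ⊔ Ideal.span {a}) l

theorem RegularSeq.hasGrade {I : Ideal R} :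
    ∀ {l : List R} {A : Ideal R}, RegularSeq A l → (∀ a ∈ l, a ∈ I) → HasGrade I l.length A
  | [], _, _, _ => trivial
  | a :: l, A, h, hl => ⟨a, hl a (by simp), h.1, h.2.hasGrade fun b hb => hl b (by simp [hb])⟩

theorem mem_sup_span_singleton {A : Ideal R} {a r : R} :
    r ∈ A ⊔ Ideal.span {a} ↔ ∃ s, r - a * s ∈ A := by
  rw [Submodule.mem_sup]
  constructor
  · rintro ⟨y, hy, z, hz, rfl⟩
    obtain ⟨s, rfl⟩ := Ideal.mem_span_singleton'.1 hz
    exact ⟨s, by convert hy using 1; ring⟩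
  · rintro ⟨s, hs⟩
    exact ⟨_, hs, a * s, Ideal.mul_mem_right _ _ (Ideal.mem_span_singleton_self a), by ring⟩

/-- This is the half of the permutability of a regular sequence that holds in every ring: from c r ≡
a s one gets s ≡ c t modulo A and c, and c can be cancelled in c (r - a t) ≡ 0. -/
theorem RegularMod.swap {A : Ideal R} {a c : R} (hc : RegularMod A c)
    (hc' : RegularMod (A ⊔ Ideal.span {c}) a) :
    RegularMod (A ⊔ Ideal.span {a}) c := by
  intro r hr
  obtain ⟨s, hs⟩ := mem_sup_span_singleton.1 hr
  have h1 : s ∈ A ⊔ Ideal.span {c} := hc' s (mem_sup_span_singleton.2 ⟨r, by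
    have := A.neg_mem hs
    convert this using 1; ring⟩)
  obtain ⟨t, ht⟩ := mem_sup_span_singleton.1 h1
  refine mem_sup_span_singleton.2 ⟨t, hc _ ?_⟩
  have := A.add_mem hs (A.mul_mem_left a ht)
  convert this using 1; ring

/-- No nonzero element of `R ⧸ A` is annihilated by `I`. -/
def TorsionFreeMod (I A : Ideal R) : Prop := ∀ m, (∀ x ∈ I, x * m ∈ A) → m ∈ A

theorem RegularMod.torsionFreeMod {I A : Ideal R} {a : R} (h : RegularMod A a) (ha : a ∈ I) :
    TorsionFreeMod I A := fun m hm => h m (hm a ha)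

/-- With M = R/A, both Hom(R/I, M/aM) and Hom(R/I, M/bM) are Ext¹(R/I, M), so one vanishes when the
other does. By hand: if I m ⊆ bM and a m = b m', then I m' ⊆ aM. -/
theorem TorsionFreeMod.exchange {I A : Ideal R} {a b : R} (ha : RegularMod A a)
    (hb : RegularMod A b) (haI : a ∈ I) (h : TorsionFreeMod I (A ⊔ Ideal.span {a})) :
    TorsionFreeMod I (A ⊔ Ideal.span {b}) := by
  intro m hm
  obtain ⟨m', hm'⟩ := mem_sup_span_singleton.1 (hm a haI)
  have h1 : m' ∈ A ⊔ Ideal.span {a} := by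
    refine h _ fun x hx => ?_
    obtain ⟨s, hs⟩ := mem_sup_span_singleton.1 (hm x hx)
    refine mem_sup_span_singleton.2 ⟨s, hb _ ?_⟩
    have := A.sub_mem (A.mul_mem_left a hs) (A.mul_mem_left x hm')
    convert this using 1; ring
  obtain ⟨t, ht⟩ := mem_sup_span_singleton.1 h1
  refine mem_sup_span_singleton.2 ⟨t, ha _ ?_⟩
  have := A.add_mem hm' (A.mul_mem_left b ht)
  convert this using 1; ring

theorem regularMod_iff {A : Ideal R} {a : R} : RegularMod A a ↔ IsSMulRegular (R ⧸ A) a := by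
  rw [isSMulRegular_quotient_iff_mem_of_smul_mem]; rfl

/-- A vector space of elements generating `I` up to radical contains an element which is a
non-zero-divisor modulo finitely many ideals on which `I` has positive grade. -/
theorem exists_regularMod {K : Type*} [Field K] [Infinite K] [Algebra K R] [IsNoetherianRing R]
    {I : Ideal R} (V : Submodule K R) (hV : I ≤ (Ideal.span (V : Set R)).radical)
    (S : Finset (Ideal R)) (hS : ∀ A ∈ S, TorsionFreeMod I A) :
    ∃ c ∈ V, ∀ A ∈ S, RegularMod A c := by
  classical
  let T : Set (Ideal R) := ⋃ A ∈ S, associatedPrimes R (R ⧸ A)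
  have hT : T.Finite := S.finite_toSet.biUnion fun A _ => associatedPrimes.finite R (R ⧸ A)
  let s : Finset (Subspace K V) :=
    hT.toFinset.image fun p => (p.restrictScalars K).comap V.subtype
  -- If V lay in an associated prime p, so would I. As p is the annihilator of a class m, I would
  -- kill m, so m ∈ A and p = R. Hence every p cuts V in a proper subspace, and over an infinite
  -- field finitely many of these do not cover V.
  have hs : ⊤ ∉ s := by
    intro htop
    obtain ⟨p, hp, hpV⟩ := Finset.mem_image.1 htop
    obtain ⟨A, hA, hpA⟩ := Set.mem_iUnion₂.1 (hT.mem_toFinset.1 hp)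
    have hVp : (V : Set R) ⊆ p := fun v hv => by
      have : (⟨v, hv⟩ : V) ∈ (p.restrictScalars K).comap V.subtype := by rw [hpV]; trivial
      exact this
    have hprime : p.IsPrime := hpA.isPrime
    have hIp : I ≤ p := hV.trans (hprime.radical_le_iff.2 (Ideal.span_le.2 hVp))
    obtain ⟨-, y, hy⟩ := isAssociatedPrime_iff.1 (AssociatedPrimes.mem_iff.1 hpA)
    obtain ⟨m, rfl⟩ := Ideal.Quotient.mk_surjective y
    have hmem : ∀ x, x ∈ p ↔ x * m ∈ A := fun x => by
      rw [hy, Submodule.mem_colon_singleton, Submodule.mem_bot, ← Ideal.Quotient.eq_zero_iff_mem]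
      rfl
    exact hprime.ne_top ((Ideal.eq_top_iff_one _).2 ((hmem 1).2
      (by simpa using hS A hA m fun x hx => (hmem x).1 (hIp hx))))
  have hne := Subspace.biUnion_ne_univ_of_top_notMem hs
  obtain ⟨c, hc⟩ := (Set.ne_univ_iff_exists_notMem _).1 hne
  refine ⟨c, c.2, fun A hA => ?_⟩
  rw [regularMod_iff]
  by_contra hreg
  have : (c : R) ∈ ⋃ p ∈ associatedPrimes R (R ⧸ A), (p : Set R) := by
    rw [biUnion_associatedPrimes_eq_compl_regular]; exact hreg
  obtain ⟨p, hp, hcp⟩ := Set.mem_iUnion₂.1 this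
  refine hc (Set.mem_iUnion₂.2 ⟨_, Finset.mem_image.2 ⟨p, hT.mem_toFinset.2 ?_, rfl⟩, hcp⟩)
  exact Set.mem_iUnion₂.2 ⟨A, hA, hp⟩

/-- Prime avoidance gives c ∈ I regular modulo A, A + (a) and A + (b) at once. Such a c can be
swapped with either element, so the induction hypothesis carries the grade from a to c and from c to
b. -/
theorem HasGrade.exchange (K : Type*) [Field K] [Infinite K] [Algebra K R] [IsNoetherianRing R]
    {I : Ideal R} : ∀ {j : ℕ} {A : Ideal R}, HasGrade I (j + 1) A → ∀ {b : R}, b ∈ I →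
      RegularMod A b → HasGrade I j (A ⊔ Ideal.span {b}) := by
  classical
  intro j
  induction j with
  | zero => intros; trivial
  | succ j ih =>
    rintro A ⟨a, haI, ha, hgr⟩ b hbI hb
    obtain ⟨c₀, hc₀I, hc₀, -⟩ := id hgr
    have t1 := hc₀.torsionFreeMod hc₀I
    have t2 := t1.exchange ha hb haI
    obtain ⟨c, hcI, hc⟩ := exists_regularMod (K := K) (I := I) (I.restrictScalars K)
      (by simpa using Ideal.le_radical) {A, A ⊔ Ideal.span {a}, A ⊔ Ideal.span {b}} (by
        simp only [Finset.mem_insert, Finset.mem_singleton]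
        rintro B (rfl | rfl | rfl)
        exacts [ha.torsionFreeMod haI, t1, t2])
    have hcI : c ∈ I := hcI
    have hcA := hc A (by simp)
    have hca := hc (A ⊔ Ideal.span {a}) (by simp)
    have hcb := hc (A ⊔ Ideal.span {b}) (by simp)
    have h1 : HasGrade I (j + 1) (A ⊔ Ideal.span {c}) :=
      ⟨a, haI, ha.swap hca, by rw [sup_right_comm]; exact ih hgr hcI hca⟩
    exact ⟨c, hcI, hcb, by rw [sup_right_comm]; exact ih h1 hbI (hb.swap hcb)⟩

/-- Each new term is taken from the vector space V rather than from the ideal it generates; when V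
consists of forms of one degree, so does the sequence. -/
theorem HasGrade.exists_regularSeq {K : Type*} [Field K] [Infinite K] [Algebra K R]
    [IsNoetherianRing R] {I : Ideal R} (V : Submodule K R) (hVI : ∀ v ∈ V, v ∈ I)
    (hV : I ≤ (Ideal.span (V : Set R)).radical) :
    ∀ {j : ℕ} {A : Ideal R}, HasGrade I j A →
      ∃ l : List R, l.length = j ∧ (∀ q ∈ l, q ∈ V) ∧ RegularSeq A l := by
  intro j
  induction j with
  | zero => intro A _; exact ⟨[], rfl, by simp, trivial⟩
  | succ j ih =>
    intro A h
    obtain ⟨a, haI, ha, -⟩ := id h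
    obtain ⟨c, hcV, hc⟩ := exists_regularMod V hV {A} (by
      simpa using ha.torsionFreeMod haI)
    have hc := hc A (by simp)
    obtain ⟨l, hl, hlV, hlr⟩ := ih (h.exchange K (hVI c hcV) hc)
    exact ⟨c :: l, by simp [hl], by simpa [hcV] using hlV, hc, hlr⟩

end Grade

/-! ### Hilbert series of homogeneous ideals -/

section Hilbert

open MvPolynomial

variable {σ K : Type*} [Field K]

theorem homogeneousComponent_mul_of_isHomogeneous {d : ℕ} {q : MvPolynomial σ K}
    (hq : q.IsHomogeneous d) (k : ℕ) (r : MvPolynomial σ K) :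
    homogeneousComponent k (r * q) =
      if d ≤ k then homogeneousComponent (k - d) r * q else 0 := by
  conv_lhs => rw [← sum_homogeneousComponent r, Finset.sum_mul, map_sum]
  have h : ∀ i, homogeneousComponent k (homogeneousComponent i r * q) =
      if i + d = k then homogeneousComponent i r * q else 0 := fun i => by
    rw [homogeneousComponent_of_mem ((homogeneousComponent_isHomogeneous i r).mul hq)]
    simp only [eq_comm]
  simp_rw [h]
  split_ifs with hdk
  · rw [Finset.sum_eq_single (k - d)]
    · rw [if_pos (by omega)]
    · intro b _ hb
      rw [if_neg (by omega)]
    · intro hb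
      rw [homogeneousComponent_eq_zero _ _ (by simp at hb; omega)]
      simp
  · exact Finset.sum_eq_zero fun i _ => if_neg (by omega)

/-- The ideal `A` contains the homogeneous components of its elements. -/
def IsGradedIdeal (A : Ideal (MvPolynomial σ K)) : Prop :=
  ∀ p ∈ A, ∀ e, homogeneousComponent e p ∈ A

theorem IsGradedIdeal.bot : IsGradedIdeal (⊥ : Ideal (MvPolynomial σ K)) := by
  rintro p hp e
  rw [Ideal.mem_bot] at hp ⊢
  simp [hp]

theorem IsGradedIdeal.sup {A : Ideal (MvPolynomial σ K)} (hA : IsGradedIdeal A) {d : ℕ}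
    {q : MvPolynomial σ K} (hq : q.IsHomogeneous d) :
    IsGradedIdeal (A ⊔ Ideal.span {q}) := by
  intro p hp e
  obtain ⟨s, hs⟩ := mem_sup_span_singleton.1 hp
  have h := hA _ hs e
  rw [map_sub, mul_comm, homogeneousComponent_mul_of_isHomogeneous hq] at h
  refine mem_sup_span_singleton.2 ?_
  split_ifs at h
  · exact ⟨_, by rwa [mul_comm]⟩
  · exact ⟨0, by simpa using h⟩

/-- The homogeneous part of degree `e` of an ideal. -/
def gradedPart (A : Ideal (MvPolynomial σ K)) (e : ℕ) : Submodule K (MvPolynomial σ K) :=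
  A.restrictScalars K ⊓ homogeneousSubmodule σ K e

theorem regularMod_X {S : Set σ} {i : σ} (hi : i ∉ S) :
    RegularMod (Ideal.span (X '' S) : Ideal (MvPolynomial σ K)) (X i) := by
  intro r hr
  rw [mem_ideal_span_X_image] at hr ⊢
  intro m hm
  obtain ⟨j, hj, hmj⟩ := hr (m + Finsupp.single i 1) (by
    rw [mem_support_iff, mul_comm, coeff_mul_X]
    exact mem_support_iff.1 hm)
  refine ⟨j, hj, ?_⟩
  have hij : i ≠ j := fun h => hi (h ▸ hj)
  simpa [hij] using hmj

theorem regularSeq_X : ∀ {l : List σ} {S : Set σ}, l.Nodup → (∀ i ∈ l, i ∉ S) →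
    RegularSeq (Ideal.span (X '' S) : Ideal (MvPolynomial σ K)) (l.map X)
  | [], _, _, _ => trivial
  | i :: l, S, hl, hS => by
    refine ⟨regularMod_X (hS i (by simp)), ?_⟩
    rw [← Ideal.span_union, ← Set.image_singleton, ← Set.image_union]
    refine regularSeq_X hl.of_cons fun j hj => ?_
    have : j ≠ i := fun h => (List.nodup_cons.1 hl).1 (h ▸ hj)
    simp [this, hS j (by simp [hj])]

/-- The Hilbert function of the quotient by an ideal. -/
def hilbertFun (A : Ideal (MvPolynomial σ K)) (e : ℕ) : ℤ :=
  Module.finrank K (homogeneousSubmodule σ K e) - Module.finrank K (gradedPart A e)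

theorem hilbertFun_eq_zero {A : Ideal (MvPolynomial σ K)} {e : ℕ}
    (h : ∀ p : MvPolynomial σ K, p.IsHomogeneous e → p ∈ A) : hilbertFun A e = 0 := by
  have : gradedPart A e = homogeneousSubmodule σ K e := inf_eq_right.2 h
  rw [hilbertFun, this]
  simp

theorem hilbertFun_sup_of_lt {A : Ideal (MvPolynomial σ K)} (hA : IsGradedIdeal A) {d : ℕ}
    {q : MvPolynomial σ K} (hq : q.IsHomogeneous d) {e : ℕ} (he : e < d) :
    hilbertFun (A ⊔ Ideal.span {q}) e = hilbertFun A e := by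
  have : gradedPart (A ⊔ Ideal.span {q}) e = gradedPart A e := by
    refine le_antisymm (fun p hp => ⟨?_, hp.2⟩) (inf_le_inf_right _ fun _ h => Ideal.mem_sup_left h)
    obtain ⟨s, hs⟩ := mem_sup_span_singleton.1 hp.1
    have h := hA _ hs e
    rwa [map_sub, mul_comm, homogeneousComponent_mul_of_isHomogeneous hq, if_neg (by omega),
      homogeneousComponent_eq_self hp.2, sub_zero] at h
  rw [hilbertFun, hilbertFun, this]

variable [Finite σ]

instance finite_homogeneousSubmodule (e : ℕ) :
    FiniteDimensional K (homogeneousSubmodule σ K e) :=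
  Module.Finite.iff_fg.2 (homogeneousSubmodule_fg σ K e)

instance finite_gradedPart (A : Ideal (MvPolynomial σ K)) (e : ℕ) :
    FiniteDimensional K (gradedPart A e) :=
  Submodule.finiteDimensional_of_le inf_le_right

theorem hilbertFun_nonneg (A : Ideal (MvPolynomial σ K)) (e : ℕ) : 0 ≤ hilbertFun A e := by
  have := Submodule.finrank_mono (R := K) (s := gradedPart A e)
    (t := homogeneousSubmodule σ K e) inf_le_right
  simp only [hilbertFun]
  omega

theorem hilbertFun_anti {A B : Ideal (MvPolynomial σ K)} (h : A ≤ B) (e : ℕ) :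
    hilbertFun B e ≤ hilbertFun A e := by
  have := Submodule.finrank_mono (R := K) (s := gradedPart A e) (t := gradedPart B e)
    (inf_le_inf_right _ h)
  simp only [hilbertFun]
  omega

/-- Dimension count in the exact sequence 0 → (S/A)(-d) → S/A → S/(A + q) → 0 given by
multiplication by q. Regularity says that A meets q S in q A. -/
theorem hilbertFun_sup_add {A : Ideal (MvPolynomial σ K)} (hA : IsGradedIdeal A) {d : ℕ}
    {q : MvPolynomial σ K} (hq : q.IsHomogeneous d) (hreg : RegularMod A q) (e : ℕ) :
    hilbertFun (A ⊔ Ideal.span {q}) (e + d) = hilbertFun A (e + d) - hilbertFun A e := by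
  -- Regularity does not exclude q = 0 when A is the unit ideal; this case is split off because
  -- multiplication by q must be injective below.
  by_cases h0 : q = 0
  · have : A = ⊤ := (Ideal.eq_top_iff_one _).2 (hreg 1 (by simp [h0]))
    rw [this, top_sup_eq, hilbertFun_eq_zero (by simp), hilbertFun_eq_zero (by simp)]
    rfl
  let M : MvPolynomial σ K →ₗ[K] MvPolynomial σ K := LinearMap.mulLeft K q
  have hM : Function.Injective M := fun a b hab => mul_left_cancel₀ h0 hab
  have h1 : gradedPart (A ⊔ Ideal.span {q}) (e + d) =
      gradedPart A (e + d) ⊔ (homogeneousSubmodule σ K e).map M := by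
    apply le_antisymm
    · intro p hp
      obtain ⟨s, hs⟩ := mem_sup_span_singleton.1 hp.1
      have h := hA _ hs (e + d)
      rw [map_sub, mul_comm, homogeneousComponent_mul_of_isHomogeneous hq, if_pos (by omega),
        homogeneousComponent_eq_self hp.2, Nat.add_sub_cancel] at h
      have hs' := homogeneousComponent_isHomogeneous e s
      refine Submodule.mem_sup.2 ⟨_, ⟨h, ?_⟩, M (homogeneousComponent e s), ⟨_, hs', rfl⟩, ?_⟩
      · exact Submodule.sub_mem _ hp.2 (hs'.mul hq)
      · simp [M, mul_comm]
    · refine sup_le (inf_le_inf_right _ fun _ h => Ideal.mem_sup_left h) ?_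
      rintro _ ⟨s, hs, rfl⟩
      refine ⟨Ideal.mem_sup_right (Ideal.mul_mem_right _ _ (Ideal.mem_span_singleton_self q)), ?_⟩
      rw [add_comm]
      exact hq.mul hs
  have h2 : gradedPart A (e + d) ⊓ (homogeneousSubmodule σ K e).map M = (gradedPart A e).map M := by
    apply le_antisymm
    · rintro _ ⟨hp, s, hs, rfl⟩
      exact ⟨s, ⟨hreg s hp.1, hs⟩, rfl⟩
    · rintro _ ⟨s, hs, rfl⟩
      refine ⟨⟨Ideal.mul_mem_left _ _ hs.1, ?_⟩, s, hs.2, rfl⟩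
      rw [add_comm]
      exact hq.mul hs.2
  have h3 := Submodule.finrank_sup_add_finrank_inf_eq (gradedPart A (e + d))
    ((homogeneousSubmodule σ K e).map M)
  rw [← h1, h2, (Submodule.equivMapOfInjective M hM _).symm.finrank_eq,
    (Submodule.equivMapOfInjective M hM _).symm.finrank_eq] at h3
  simp only [hilbertFun]
  omega

/-- The Hilbert series of the quotient by an ideal. -/
def hilbertSeries (A : Ideal (MvPolynomial σ K)) : PowerSeries ℤ := PowerSeries.mk (hilbertFun A)

theorem hilbertSeries_sup {A : Ideal (MvPolynomial σ K)} (hA : IsGradedIdeal A) {d : ℕ}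
    {q : MvPolynomial σ K} (hq : q.IsHomogeneous d) (hreg : RegularMod A q) :
    hilbertSeries (A ⊔ Ideal.span {q}) = (1 - PowerSeries.X ^ d) * hilbertSeries A := by
  ext e
  rw [sub_mul, one_mul, map_sub, PowerSeries.coeff_X_pow_mul']
  simp only [hilbertSeries, PowerSeries.coeff_mk]
  split_ifs with h
  · obtain ⟨k, rfl⟩ := Nat.exists_eq_add_of_le' h
    rw [hilbertFun_sup_add hA hq hreg, Nat.add_sub_cancel]
  · rw [hilbertFun_sup_of_lt hA hq (by omega), sub_zero]

theorem hilbertSeries_regularSeq {d : ℕ} :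
    ∀ {l : List (MvPolynomial σ K)} {A : Ideal (MvPolynomial σ K)}, IsGradedIdeal A →
      (∀ q ∈ l, q.IsHomogeneous d) → RegularSeq A l →
      hilbertSeries (A ⊔ Ideal.span {q | q ∈ l}) =
        (1 - PowerSeries.X ^ d) ^ l.length * hilbertSeries A
  | [], A, _, _, _ => by simp
  | q :: l, A, hA, hl, hreg => by
    have hq : q.IsHomogeneous d := hl q (by simp)
    have ih := hilbertSeries_regularSeq (hA.sup hq) (fun r hr => hl r (by simp [hr])) hreg.2
    have : A ⊔ Ideal.span {r | r ∈ q :: l} = A ⊔ Ideal.span {q} ⊔ Ideal.span {r | r ∈ l} := by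
      rw [sup_assoc, ← Ideal.span_union]
      congr 2
      ext; simp
    rw [this, ih, hilbertSeries_sup hA hq hreg.1, List.length_cons, pow_succ, mul_assoc]

end Hilbert

/-! ### Complete intersections of n forms in n variables -/

section HilbertFin

open MvPolynomial

variable {n : ℕ} {K : Type*} [Field K]

theorem regularSeq_vars :
    RegularSeq (⊥ : Ideal (MvPolynomial (Fin n) K)) ((List.finRange n).map X) := by
  have := regularSeq_X (K := K) (l := List.finRange n) (S := ∅) (List.nodup_finRange n) (by simp)
  simpa using this

theorem hilbertSeries_vars :
    hilbertSeries (Ideal.span (Set.range (X : Fin n → MvPolynomial (Fin n) K))) = 1 := by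
  ext e
  rw [hilbertSeries, PowerSeries.coeff_mk, PowerSeries.coeff_one, ← Set.image_univ]
  split_ifs with he
  · subst he
    have h1 : gradedPart (Ideal.span (X '' Set.univ)) 0 =
        (⊥ : Submodule K (MvPolynomial (Fin n) K)) := by
      rw [eq_bot_iff]
      rintro p ⟨hp, hp0⟩
      have hp := mem_ideal_span_X_image.1 hp
      rw [Submodule.mem_bot, ← support_eq_empty, Finset.eq_empty_iff_forall_notMem]
      intro m hm
      obtain ⟨i, -, hi⟩ := hp m hm
      have : m.degree = 0 := by
        by_contra h
        exact mem_support_iff.1 hm (IsHomogeneous.coeff_eq_zero hp0 h)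
      rw [Finsupp.degree_eq_zero_iff] at this
      simp [this] at hi
    rw [hilbertFun, h1, homogeneousSubmodule_zero, Submodule.one_eq_span,
      finrank_span_singleton one_ne_zero]
    simp
  · refine hilbertFun_eq_zero fun p hp => mem_ideal_span_X_image.2 fun m hm => ?_
    by_contra! hcon
    have hm0 : m = 0 := Finsupp.ext fun i => hcon i trivial
    refine mem_support_iff.1 hm (hp.coeff_eq_zero ?_)
    simpa [hm0] using Ne.symm he

/-- The variables are themselves a regular sequence of degree 1 with quotient K, so the product
formula yields the series of the polynomial ring without counting monomials. -/
theorem one_sub_X_pow_mul_hilbertSeries_bot :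
    (1 - PowerSeries.X) ^ n * hilbertSeries (⊥ : Ideal (MvPolynomial (Fin n) K)) = 1 := by
  have h := hilbertSeries_regularSeq (d := 1) IsGradedIdeal.bot (by
    simp [isHomogeneous_X]) (regularSeq_vars (n := n) (K := K))
  rw [bot_sup_eq] at h
  have h2 : {q | q ∈ (List.finRange n).map (X : Fin n → MvPolynomial (Fin n) K)} =
      Set.range X := by
    ext; simp
  rw [h2, hilbertSeries_vars] at h
  simpa using h.symm

theorem hilbertSeries_eq_geom_pow {d : ℕ} {l : List (MvPolynomial (Fin n) K)}
    (hl : ∀ q ∈ l, q.IsHomogeneous d) (hlen : l.length = n) (hreg : RegularSeq ⊥ l) :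
    hilbertSeries (Ideal.span {q | q ∈ l}) =
      (((∑ i ∈ Finset.range d, Polynomial.X ^ i) ^ n : Polynomial ℤ) : PowerSeries ℤ) := by
  have h := hilbertSeries_regularSeq IsGradedIdeal.bot hl hreg
  rw [bot_sup_eq, hlen] at h
  have hne : (1 - PowerSeries.X : PowerSeries ℤ) ^ n ≠ 0 := by
    refine pow_ne_zero _ fun h => ?_
    simpa using congrArg (PowerSeries.coeff 0) h
  refine mul_left_cancel₀ hne ?_
  rw [h, mul_left_comm, one_sub_X_pow_mul_hilbertSeries_bot, mul_one, Polynomial.coe_pow, ← mul_pow]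
  congr 1
  have := mul_neg_geom_sum (PowerSeries.X : PowerSeries ℤ) d
  rw [← this]
  congr 1
  have h3 := map_sum (Polynomial.coeToPowerSeries.ringHom (R := ℤ)) (fun i => Polynomial.X ^ i)
    (Finset.range d)
  simp only [map_pow, Polynomial.coeToPowerSeries.ringHom_apply, Polynomial.coe_X] at h3
  exact h3.symm

/-- The Hilbert series is the polynomial (1 + X + … + X^(d-1))^n with value d^n at 1, and partial
sums of its nonnegative coefficients cannot exceed that value. -/
theorem sum_hilbertFun_le {d : ℕ} {l : List (MvPolynomial (Fin n) K)}
    (hl : ∀ q ∈ l, q.IsHomogeneous d) (hlen : l.length = n) (hreg : RegularSeq ⊥ l) (k : ℕ) :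
    ∑ e ∈ Finset.range k, hilbertFun (Ideal.span {q | q ∈ l}) e ≤ (d : ℤ) ^ n := by
  have h := hilbertSeries_eq_geom_pow hl hlen hreg
  set p : Polynomial ℤ := (∑ i ∈ Finset.range d, Polynomial.X ^ i) ^ n with hp
  have hcoef : ∀ e, hilbertFun (Ideal.span {q | q ∈ l}) e = p.coeff e := fun e => by
    have := congrArg (PowerSeries.coeff e) h
    simpa [hilbertSeries] using this
  have heval : p.eval 1 = (d : ℤ) ^ n := by
    simp [hp, Polynomial.eval_finsetSum]
  rw [← heval, Polynomial.eval_eq_sum_range' (n := max k (p.natDegree + 1)) (by omega)]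
  simp_rw [one_pow, mul_one, ← hcoef]
  exact Finset.sum_le_sum_of_subset_of_nonneg (Finset.range_mono (le_max_left _ _))
    fun e _ _ => hilbertFun_nonneg _ e

/-- If `n` forms of degree `d ≥ 1` in `n` variables generate an ideal that contains all forms of some
degree, then the sum of the Hilbert function of the quotient is at most `d ^ n`. -/
theorem sum_hilbertFun_span_le [Infinite K] {d : ℕ} (hd : d ≠ 0)
    {P : Fin n → MvPolynomial (Fin n) K} (hP : ∀ i, (P i).IsHomogeneous d) {k : ℕ}
    (hk : ∀ p : MvPolynomial (Fin n) K, p.IsHomogeneous k → p ∈ Ideal.span (Set.range P)) (N : ℕ) :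
    ∑ e ∈ Finset.range N, hilbertFun (Ideal.span (Set.range P)) e ≤ (d : ℤ) ^ n := by
  let I : Ideal (MvPolynomial (Fin n) K) := Ideal.span (Set.range X)
  let V : Submodule K (MvPolynomial (Fin n) K) := Submodule.span K (Set.range P)
  have hVhom : ∀ v ∈ V, v.IsHomogeneous d := fun v hv =>
    (Submodule.span_le (p := homogeneousSubmodule (Fin n) K d)).2
      (by rintro _ ⟨i, rfl⟩; exact hP i) hv
  have hVP : Ideal.span (V : Set (MvPolynomial (Fin n) K)) = Ideal.span (Set.range P) :=
    le_antisymm (Ideal.span_le.2 fun v hv => (Submodule.span_le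
      (p := (Ideal.span (Set.range P)).restrictScalars K)).2 Ideal.subset_span hv)
      (Ideal.span_mono Submodule.subset_span)
  have hVI : ∀ v ∈ V, v ∈ I := fun v hv => by
    have : v ∈ Ideal.span (X '' Set.univ : Set (MvPolynomial (Fin n) K)) := by
      rw [mem_ideal_span_X_image]
      intro m hm
      by_contra! hcon
      have hm0 : m = 0 := Finsupp.ext fun i => hcon i trivial
      have := hVhom v hv (mem_support_iff.1 hm)
      simp [hm0] at this
      exact hd this.symm
    simpa [I] using this
  have hrad : I ≤ (Ideal.span (V : Set (MvPolynomial (Fin n) K))).radical := by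
    rw [hVP]
    refine Ideal.span_le.2 ?_
    rintro _ ⟨i, rfl⟩
    exact ⟨k, hk _ (isHomogeneous_X_pow i k)⟩
  have hgr : HasGrade I n ⊥ := by
    have := (regularSeq_vars (n := n) (K := K)).hasGrade (I := I) (by
      intro a ha
      obtain ⟨i, -, rfl⟩ := List.mem_map.1 ha
      exact Ideal.subset_span ⟨i, rfl⟩)
    simpa using this
  obtain ⟨l, hlen, hlV, hreg⟩ := hgr.exists_regularSeq V hVI hrad
  -- The regular sequence lies in V, so it generates an ideal inside (Pᵢ); a smaller ideal has a
  -- larger Hilbert function, and equality of the ideals is not needed.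
  refine le_trans (Finset.sum_le_sum fun e _ => hilbertFun_anti ?_ e)
    (sum_hilbertFun_le (fun q hq => hVhom q (hlV q hq)) hlen hreg N)
  rw [← hVP]
  exact Ideal.span_mono fun q hq => hlV q hq

end HilbertFin

/-! ### Local algebras whose associated graded ring is a polynomial ring -/

section Local

open MvPolynomial

variable {n : ℕ} {K E : Type*} [Field K] [CommRing E] [Algebra K E] (x : Fin n → E)

/-- The ideal generated by a family of elements. -/
abbrev famIdeal {ι E : Type*} [CommRing E] (x : ι → E) : Ideal E := Ideal.span (Set.range x)

theorem aeval_mem_pow {p : MvPolynomial (Fin n) K} {k : ℕ} (hp : p.IsHomogeneous k) :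
    aeval x p ∈ famIdeal x ^ k := by
  rw [Ideal.mem_span_pow_iff_exists_isHomogeneous]
  exact ⟨map (algebraMap K E) p, hp.map _, by rw [eval_map, aeval_def]⟩

/-- The conditions on a family of elements `x` of a `K`-algebra `E` under which `E` behaves like the
local ring of germs with coordinates `x`. -/
structure IsCoordinates (K : Type*) {E : Type*} [Field K] [CommRing E] [Algebra K E]
    (x : Fin n → E) : Prop where
  exists_const : ∀ φ : E, ∃ c : K, φ - algebraMap K E c ∈ famIdeal x
  eq_zero : ∀ (k : ℕ) (p : MvPolynomial (Fin n) K), p.IsHomogeneous k →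
    aeval x p ∈ famIdeal x ^ (k + 1) → p = 0
  le_jacobson : famIdeal x ≤ Ideal.jacobson ⊥

namespace IsCoordinates

variable {x}

/-- An element of 𝔪^k is a form in x with coefficients in E; replacing each coefficient by its
constant term changes it by an element of 𝔪^(k+1). -/
theorem exists_homogeneous (hx : IsCoordinates K x) {k : ℕ} {φ : E} (hφ : φ ∈ famIdeal x ^ k) :
    ∃ p : MvPolynomial (Fin n) K, p.IsHomogeneous k ∧ φ - aeval x p ∈ famIdeal x ^ (k + 1) := by
  rw [Ideal.mem_span_pow_iff_exists_isHomogeneous] at hφ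
  obtain ⟨P, hP, rfl⟩ := hφ
  choose c hc using hx.exists_const
  refine ⟨∑ m ∈ P.support, monomial m (c (P.coeff m)),
    IsHomogeneous.sum _ _ _ fun m hm => isHomogeneous_monomial _ ?_, ?_⟩
  · by_contra h
    exact mem_support_iff.1 hm (hP.coeff_eq_zero h)
  · rw [eval_eq', map_sum, ← Finset.sum_sub_distrib]
    refine Ideal.sum_mem _ fun m hm => ?_
    have hdeg : m.degree = k := by
      by_contra h
      exact mem_support_iff.1 hm (hP.coeff_eq_zero h)
    have h1 := aeval_mem_pow (K := K) x (isHomogeneous_monomial (1 : K) hdeg)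
    rw [aeval_monomial, map_one, one_mul] at h1
    rw [aeval_monomial, ← Finsupp.prod_fintype _ _ (by simp), ← sub_mul, pow_succ']
    exact Ideal.mul_mem_mul (hc _) h1

theorem exists_poly (hx : IsCoordinates K x) (φ : E) (k : ℕ) :
    ∃ p : MvPolynomial (Fin n) K, p.totalDegree ≤ k ∧ φ - aeval x p ∈ famIdeal x ^ (k + 1) := by
  induction k with
  | zero =>
    obtain ⟨c, hc⟩ := hx.exists_const φ
    exact ⟨C c, by simp, by simpa using hc⟩
  | succ k ih =>
    obtain ⟨p, hpd, hp⟩ := ih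
    obtain ⟨q, hq, hpq⟩ := hx.exists_homogeneous hp
    refine ⟨p + q, (totalDegree_add _ _).trans (max_le (hpd.trans (Nat.le_succ k))
      hq.totalDegree_le), ?_⟩
    rwa [map_add, ← sub_sub]

theorem homogeneousComponent_eq_zero_of_aeval_mem (hx : IsCoordinates K x) {k : ℕ}
    {p : MvPolynomial (Fin n) K} (hp : aeval x p ∈ famIdeal x ^ (k + 1)) :
    ∀ j ≤ k, homogeneousComponent j p = 0 := by
  intro j
  induction j using Nat.strong_induction_on with
  | _ j ih =>
    intro hj
    refine hx.eq_zero j _ (homogeneousComponent_isHomogeneous j p) ?_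
    have h1 : aeval x p = ∑ i ∈ Finset.range (max (p.totalDegree + 1) (j + 1)),
        aeval x (homogeneousComponent i p) := by
      rw [← map_sum]
      congr 1
      conv_lhs => rw [← sum_homogeneousComponent p]
      refine Finset.sum_subset (Finset.range_mono (le_max_left _ _)) fun i _ hi => ?_
      exact homogeneousComponent_eq_zero _ _ (by simp at hi; omega)
    rw [← Finset.add_sum_erase _ _ (Finset.mem_range.2 (lt_of_lt_of_le (Nat.lt_succ_self j)
      (le_max_right _ _)))] at h1
    rw [eq_sub_of_add_eq h1.symm]
    refine Ideal.sub_mem _ (Ideal.pow_le_pow_right (by omega) hp) (Ideal.sum_mem _ fun i hi => ?_)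
    rcases lt_or_gt_of_ne (Finset.ne_of_mem_erase hi) with h | h
    · rw [ih i h (by omega)]; simp
    · exact Ideal.pow_le_pow_right h (aeval_mem_pow x (homogeneousComponent_isHomogeneous i p))

theorem isUnit_of_const_ne_zero (hx : IsCoordinates K x) {φ : E} {c : K} (hc : c ≠ 0)
    (h : φ - algebraMap K E c ∈ famIdeal x) : IsUnit φ := by
  have h1 := hx.le_jacobson h
  have h2 := (Ideal.mem_jacobson_bot.1 h1) (algebraMap K E c⁻¹)
  have hcc : algebraMap K E c * algebraMap K E c⁻¹ = 1 := by
    rw [← map_mul, mul_inv_cancel₀ hc, map_one]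
  have : (φ - algebraMap K E c) * algebraMap K E c⁻¹ + 1 = φ * algebraMap K E c⁻¹ := by
    rw [sub_mul, hcc]; ring
  rw [this] at h2
  exact isUnit_of_mul_isUnit_left h2

end IsCoordinates

theorem isGradedIdeal_famIdeal {ι : Type*} [Finite ι] {d : ℕ} {P : ι → MvPolynomial (Fin n) K}
    (hP : ∀ i, (P i).IsHomogeneous d) : IsGradedIdeal (famIdeal P) := by
  have := Fintype.ofFinite ι
  intro p hp e
  obtain ⟨r, rfl⟩ := (Ideal.mem_span_range_iff_exists_fun).1 hp
  rw [map_sum]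
  refine Ideal.sum_mem _ fun i _ => ?_
  rw [homogeneousComponent_mul_of_isHomogeneous (hP i)]
  split_ifs
  · exact Ideal.mul_mem_left _ _ (Ideal.subset_span ⟨i, rfl⟩)
  · exact Ideal.zero_mem _

variable {x} {d : ℕ} {P : Fin n → MvPolynomial (Fin n) K} {F : Fin n → E}

/-- If the forms `P i` generate an ideal of finite codimension in `E`, then they generate all forms
of some degree. -/
theorem IsCoordinates.exists_forall_mem (hx : IsCoordinates K x)
    (hP : ∀ i, (P i).IsHomogeneous d)
    (hfin : Module.Finite K (E ⧸ famIdeal fun i => aeval x (P i))) :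
    ∃ k, ∀ p : MvPolynomial (Fin n) K, p.IsHomogeneous k → p ∈ famIdeal P := by
  set J := famIdeal fun i => aeval x (P i) with hJ
  let f : ℕ →o (Submodule K (E ⧸ J))ᵒᵈ :=
    ⟨fun k => OrderDual.toDual (((famIdeal x ^ k).restrictScalars K).map
      (Ideal.Quotient.mkₐ K J).toLinearMap), fun a b hab =>
        OrderDual.toDual_le_toDual.2 (Submodule.map_mono (Ideal.pow_le_pow_right hab))⟩
  -- The images of the powers of 𝔪 in the finite-dimensional quotient form a descending chain of
  -- subspaces; k is an index from which it is constant.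
  obtain ⟨k, hk⟩ := IsArtinian.monotone_stabilizes f
  refine ⟨k, fun p hp => ?_⟩
  have h1 : Ideal.Quotient.mk J (aeval x p) ∈ ((famIdeal x ^ (k + 1)).restrictScalars K).map
      (Ideal.Quotient.mkₐ K J).toLinearMap := by
    have : f k = f (k + 1) := hk (k + 1) (Nat.le_succ k)
    have h2 : ((famIdeal x ^ k).restrictScalars K).map (Ideal.Quotient.mkₐ K J).toLinearMap =
      ((famIdeal x ^ (k + 1)).restrictScalars K).map (Ideal.Quotient.mkₐ K J).toLinearMap := this
    rw [← h2]
    exact ⟨_, aeval_mem_pow x hp, rfl⟩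
  obtain ⟨s, hs, hsp⟩ := h1
  have h3 : aeval x p - s ∈ J := Ideal.Quotient.eq.1 hsp.symm
  obtain ⟨h, hh⟩ := (Ideal.mem_span_range_iff_exists_fun).1 h3
  -- Truncating the coefficients to polynomials costs only an element of 𝔪^(k+1), so p - ∑ rᵢ Pᵢ has
  -- no component of degree k. Thus p is the degree k component of an element of the graded ideal
  -- (Pᵢ).
  choose r _ hr using fun i => hx.exists_poly (h i) k
  have h4 : aeval x (p - ∑ i, r i * P i) ∈ famIdeal x ^ (k + 1) := by
    have : aeval x (p - ∑ i, r i * P i) =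
        s + ∑ i, (h i - aeval x (r i)) * aeval x (P i) := by
      simp only [sub_mul, Finset.sum_sub_distrib, hh, map_sub, map_sum, map_mul]
      ring
    rw [this]
    exact Ideal.add_mem _ hs (Ideal.sum_mem _ fun i _ => Ideal.mul_mem_right _ _ (hr i))
  have h5 := hx.homogeneousComponent_eq_zero_of_aeval_mem h4 k le_rfl
  rw [map_sub, homogeneousComponent_eq_self hp, sub_eq_zero] at h5
  rw [h5]
  refine isGradedIdeal_famIdeal hP _ (Ideal.sum_mem _ fun i _ => ?_) k
  exact Ideal.mul_mem_left _ _ (Ideal.subset_span ⟨i, rfl⟩)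

/-- In degree e a form of (Pᵢ) is ∑ sᵢ Pᵢ with sᵢ of degree e - d. Replacing Pᵢ by Fᵢ costs an
element of 𝔪^(e-d) 𝔪^(d+1) = 𝔪^(e+1). -/
theorem aeval_mem_sup_of_mem_gradedPart (hP : ∀ i, (P i).IsHomogeneous d)
    (hF : ∀ i, F i - aeval x (P i) ∈ famIdeal x ^ (d + 1)) {e : ℕ} {p : MvPolynomial (Fin n) K}
    (hp : p ∈ gradedPart (famIdeal P) e) : aeval x p ∈ famIdeal F ⊔ famIdeal x ^ (e + 1) := by
  obtain ⟨r, hr⟩ := (Ideal.mem_span_range_iff_exists_fun).1 hp.1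
  have h1 : p = ∑ i, homogeneousComponent e (r i * P i) := by
    rw [← map_sum, hr, homogeneousComponent_eq_self hp.2]
  rw [h1, map_sum]
  refine Ideal.sum_mem _ fun i _ => ?_
  rw [homogeneousComponent_mul_of_isHomogeneous (hP i)]
  split_ifs with hde
  · set s := homogeneousComponent (e - d) (r i)
    have hs : aeval x s ∈ famIdeal x ^ (e - d) :=
      aeval_mem_pow x (homogeneousComponent_isHomogeneous _ _)
    have : aeval x (s * P i) = aeval x s * F i - aeval x s * (F i - aeval x (P i)) := by
      rw [map_mul]; ring
    rw [this]
    refine Ideal.sub_mem _ (Ideal.mem_sup_left (Ideal.mul_mem_left _ _ (Ideal.subset_span ⟨i, rfl⟩)))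
      (Ideal.mem_sup_right ?_)
    have h2 := Ideal.mul_mem_mul hs (hF i)
    rwa [← pow_add, show e - d + (d + 1) = e + 1 by omega] at h2
  · simp

/-- Nakayama: 𝔪^k is finitely generated, contained in (F) + 𝔪·𝔪^k, and 𝔪 lies in the Jacobson
radical. -/
theorem IsCoordinates.pow_le (hx : IsCoordinates K x) (hP : ∀ i, (P i).IsHomogeneous d)
    (hF : ∀ i, F i - aeval x (P i) ∈ famIdeal x ^ (d + 1)) {k : ℕ}
    (hk : ∀ p : MvPolynomial (Fin n) K, p.IsHomogeneous k → p ∈ famIdeal P) :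
    famIdeal x ^ k ≤ famIdeal F := by
  have hfg : (famIdeal x ^ k).FG :=
    Submodule.FG.pow (Submodule.fg_span (Set.finite_range x)) k
  refine Submodule.le_of_le_smul_of_le_jacobson_bot hfg hx.le_jacobson fun φ hφ => ?_
  obtain ⟨p, hp, hφp⟩ := hx.exists_homogeneous hφ
  rw [smul_eq_mul, ← pow_succ', ← sub_add_cancel φ (aeval x p)]
  exact Ideal.add_mem _ (Ideal.mem_sup_right hφp)
    (aeval_mem_sup_of_mem_gradedPart hP hF ⟨hk p hp, hp⟩)

theorem exists_complement_gradedPart (A : Ideal (MvPolynomial (Fin n) K)) (e : ℕ) :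
    ∃ W : Submodule K (MvPolynomial (Fin n) K), FiniteDimensional K W ∧
      (Module.finrank K W : ℤ) ≤ hilbertFun A e ∧
      ∀ p : MvPolynomial (Fin n) K, p.IsHomogeneous e → ∃ w ∈ W, p - w ∈ gradedPart A e := by
  let S := homogeneousSubmodule (Fin n) K e
  let T : Submodule K S := (gradedPart A e).comap S.subtype
  obtain ⟨U, hU⟩ := Submodule.exists_isCompl T
  refine ⟨U.map S.subtype, inferInstance, ?_, fun p hp => ?_⟩
  · have h1 := Submodule.finrank_add_eq_of_isCompl hU
    have h2 : Module.finrank K T = Module.finrank K (gradedPart A e) :=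
      (Submodule.comapSubtypeEquivOfLe (inf_le_right : gradedPart A e ≤ S)).finrank_eq
    have h3 := Submodule.finrank_map_le S.subtype U
    change (Module.finrank K (U.map S.subtype) : ℤ) ≤
      Module.finrank K S - Module.finrank K (gradedPart A e)
    omega
  · have : (⟨p, hp⟩ : S) ∈ T ⊔ U := by rw [hU.sup_eq_top]; trivial
    obtain ⟨t, ht, u, hu, htu⟩ := Submodule.mem_sup.1 this
    refine ⟨u, ⟨u, hu, rfl⟩, ?_⟩
    have h1 : p = t + u := congrArg Subtype.val htu.symm
    rw [h1, add_sub_cancel_right]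
    exact ht

/-- Passing from 𝔪^k to 𝔪^(k+1) requires only new representatives for the forms of degree k modulo
those of (Pᵢ), and the Hilbert function counts these. -/
theorem IsCoordinates.exists_span_mod_pow (hx : IsCoordinates K x)
    (hP : ∀ i, (P i).IsHomogeneous d)
    (hF : ∀ i, F i - aeval x (P i) ∈ famIdeal x ^ (d + 1)) (k : ℕ) :
    ∃ U : Submodule K E, FiniteDimensional K U ∧
      (Module.finrank K U : ℤ) ≤ ∑ e ∈ Finset.range k, hilbertFun (famIdeal P) e ∧
      ∀ φ : E, ∃ u ∈ U, φ - u ∈ famIdeal F ⊔ famIdeal x ^ k := by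
  induction k with
  | zero => exact ⟨⊥, inferInstance, by simp, fun φ => ⟨0, by simp, by simp⟩⟩
  | succ k ih =>
    obtain ⟨U, hU, hUle, hUs⟩ := ih
    obtain ⟨W, hW, hWle, hWs⟩ := exists_complement_gradedPart (famIdeal P) k
    let W' : Submodule K E := W.map (aeval x).toLinearMap
    refine ⟨U ⊔ W', inferInstance, ?_, fun φ => ?_⟩
    · have h1 := Submodule.finrank_add_le_finrank_add_finrank U W'
      have h2 := Submodule.finrank_map_le (aeval x : MvPolynomial (Fin n) K →ₐ[K] E).toLinearMap W
      rw [Finset.sum_range_succ]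
      have h3 : Module.finrank K W' ≤ Module.finrank K W := h2
      omega
    · obtain ⟨u, hu, hφ⟩ := hUs φ
      obtain ⟨j, hj, s, hs, hjs⟩ := Submodule.mem_sup.1 hφ
      obtain ⟨p, hp, hsp⟩ := hx.exists_homogeneous hs
      obtain ⟨w, hw, hpw⟩ := hWs p hp
      refine ⟨u + aeval x w, Submodule.add_mem_sup hu ⟨w, hw, rfl⟩, ?_⟩
      have : φ - (u + aeval x w) = j + (s - aeval x p) + aeval x (p - w) := by
        rw [map_sub, ← sub_sub, ← hjs]; ring
      rw [this]
      exact Ideal.add_mem _ (Ideal.add_mem _ (Ideal.mem_sup_left hj) (Ideal.mem_sup_right hsp))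
        (aeval_mem_sup_of_mem_gradedPart hP hF hpw)

/-- Upper bound for the codimension of an ideal whose generators have leading forms `P i`. -/
theorem IsCoordinates.finite_finrank_le (hx : IsCoordinates K x)
    (hP : ∀ i, (P i).IsHomogeneous d)
    (hF : ∀ i, F i - aeval x (P i) ∈ famIdeal x ^ (d + 1)) {k : ℕ}
    (hk : ∀ p : MvPolynomial (Fin n) K, p.IsHomogeneous k → p ∈ famIdeal P) :
    Module.Finite K (E ⧸ famIdeal F) ∧ (Module.finrank K (E ⧸ famIdeal F) : ℤ) ≤
      ∑ e ∈ Finset.range k, hilbertFun (famIdeal P) e := by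
  obtain ⟨U, hU, hUle, hUs⟩ := hx.exists_span_mod_pow hP hF k
  rw [sup_eq_left.2 (hx.pow_le hP hF hk)] at hUs
  let f : U →ₗ[K] E ⧸ famIdeal F := (Ideal.Quotient.mkₐ K (famIdeal F)).toLinearMap ∘ₗ U.subtype
  have hf : Function.Surjective f := by
    intro y
    obtain ⟨φ, rfl⟩ := Ideal.Quotient.mk_surjective y
    obtain ⟨u, hu, hφ⟩ := hUs φ
    exact ⟨⟨u, hu⟩, (Ideal.Quotient.eq.2 hφ).symm⟩
  refine ⟨Module.Finite.of_surjective f hf, le_trans ?_ hUle⟩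
  exact_mod_cast LinearMap.finrank_le_finrank_of_surjective hf

end Local

/-! ### Lower bound for the codimension -/

section LowerBound

open MvPolynomial

/-- The exponents of the monomials of degree less than `N` in `n` variables. -/
def exponentsLT (n N : ℕ) : Finset (Fin n →₀ ℕ) :=
  (Finset.range N).biUnion fun e => Finset.univ.finsuppAntidiag e

theorem mem_antidiag_univ {n e : ℕ} {m : Fin n →₀ ℕ} :
    m ∈ (Finset.univ : Finset (Fin n)).finsuppAntidiag e ↔ m.degree = e := by
  simp [Finset.mem_finsuppAntidiag, Finsupp.degree_eq_sum]

theorem mem_exponentsLT {n N : ℕ} {m : Fin n →₀ ℕ} : m ∈ exponentsLT n N ↔ m.degree < N := by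
  simp only [exponentsLT, Finset.mem_biUnion, mem_antidiag_univ, Finset.mem_range]
  simp

theorem sum_exponentsLT {n N : ℕ} {M : Type*} [AddCommMonoid M] (f : (Fin n →₀ ℕ) → M) :
    ∑ m ∈ exponentsLT n N, f m =
      ∑ e ∈ Finset.range N, ∑ m ∈ (Finset.univ : Finset (Fin n)).finsuppAntidiag e, f m := by
  refine Finset.sum_biUnion fun a _ b _ hab => Finset.disjoint_left.2 fun m ha hb => hab ?_
  rw [← mem_antidiag_univ.1 ha, ← mem_antidiag_univ.1 hb]

theorem card_exponentsLT_succ (n N : ℕ) : (exponentsLT n (N + 1)).card = (N + n).choose n := by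
  have h1 : (exponentsLT n (N + 1)).card = ∑ e ∈ Finset.range (N + 1), n.multichoose e := by
    rw [Finset.card_eq_sum_ones, sum_exponentsLT]
    refine Finset.sum_congr rfl fun e _ => ?_
    rw [← Finset.card_eq_sum_ones, Finset.card_finsuppAntidiag_nat_eq_multichoose]
    simp
  have h2 : ∀ N, ∑ e ∈ Finset.range (N + 1), n.multichoose e = (n + 1).multichoose N := by
    intro N
    induction N with
    | zero => simp
    | succ N ih => rw [Finset.sum_range_succ, ih, Nat.multichoose_succ_succ, add_comm]
  rw [h1, h2, Nat.multichoose_eq, show n + 1 + N - 1 = N + n by omega, ← Nat.choose_symm_add]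

theorem pow_le_card_exponentsLT (n : ℕ) {N : ℕ} (hN : 1 ≤ N) :
    N ^ n ≤ n.factorial * (exponentsLT n N).card := by
  obtain ⟨M, rfl⟩ := Nat.exists_eq_add_of_le' hN
  rw [card_exponentsLT_succ, ← Nat.ascFactorial_eq_factorial_mul_choose]
  exact Nat.pow_succ_le_ascFactorial _ _

theorem card_exponentsLT_le_pow (n : ℕ) {N : ℕ} (hN : 1 ≤ N) :
    n.factorial * (exponentsLT n N).card ≤ (N + n) ^ n := by
  obtain ⟨M, rfl⟩ := Nat.exists_eq_add_of_le' hN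
  rw [card_exponentsLT_succ, ← Nat.ascFactorial_eq_factorial_mul_choose]
  exact (Nat.ascFactorial_le_pow_add _ _).trans (Nat.pow_le_pow_left (by omega) _)

variable {n : ℕ} {K E : Type*} [Field K] [CommRing E] [Algebra K E] {x F : Fin n → E} {d : ℕ}

/-- Modulo the `N`-th power of the ideal generated by `F`, every element is a polynomial in `F` of
degree less than `N` with coefficients in a set of representatives. -/
theorem exists_sub_sum_mem_pow {s : E ⧸ famIdeal F → E}
    (hs : ∀ y, Ideal.Quotient.mk (famIdeal F) (s y) = y) (N : ℕ) (φ : E) :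
    ∃ y : (Fin n →₀ ℕ) → E ⧸ famIdeal F,
      φ - ∑ m ∈ exponentsLT n N, (∏ i, F i ^ m i) * s (y m) ∈ famIdeal F ^ N := by
  induction N with
  | zero => exact ⟨0, by simp⟩
  | succ N ih =>
    obtain ⟨y, hy⟩ := ih
    obtain ⟨p, hp, hpe⟩ := (Ideal.mem_span_pow_iff_exists_isHomogeneous _ _).1 hy
    -- The remainder is a form of degree N in F. Replacing its coefficients by the representatives
    -- of their classes leaves elements of J times monomials of degree N in F, hence an error in
    -- J^(N+1).
    refine ⟨fun m => if m.degree = N then Ideal.Quotient.mk _ (p.coeff m) else y m, ?_⟩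
    rw [sum_exponentsLT, Finset.sum_range_succ]
    have h1 : ∑ e ∈ Finset.range N, ∑ m ∈ (Finset.univ : Finset (Fin n)).finsuppAntidiag e,
        (∏ i, F i ^ m i) * s (if m.degree = N then Ideal.Quotient.mk _ (p.coeff m) else y m) =
        ∑ m ∈ exponentsLT n N, (∏ i, F i ^ m i) * s (y m) := by
      rw [sum_exponentsLT]
      refine Finset.sum_congr rfl fun e he => Finset.sum_congr rfl fun m hm => ?_
      have := mem_antidiag_univ.1 hm
      have := Finset.mem_range.1 he
      rw [if_neg (by omega)]
    have h2 : p.eval F = ∑ m ∈ (Finset.univ : Finset (Fin n)).finsuppAntidiag N,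
        p.coeff m * ∏ i, F i ^ m i := by
      rw [eval_eq']
      refine Finset.sum_subset (fun m hm => mem_antidiag_univ.2 ?_) fun m _ hm => ?_
      · by_contra h
        exact mem_support_iff.1 hm (hp.coeff_eq_zero h)
      · rw [notMem_support_iff.1 hm, zero_mul]
    rw [h1, ← sub_sub, ← hpe, h2, ← Finset.sum_sub_distrib]
    refine Ideal.sum_mem _ fun m hm => ?_
    have hm := mem_antidiag_univ.1 hm
    beta_reduce
    rw [if_pos hm, mul_comm, ← mul_sub, pow_succ]
    refine Ideal.mul_mem_mul ?_ ?_
    · rw [Ideal.mem_span_pow_iff_exists_isHomogeneous]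
      exact ⟨monomial m 1, isHomogeneous_monomial _ hm, by
        rw [eval_monomial, one_mul, Finsupp.prod_fintype _ _ (by simp)]⟩
    · rw [← Ideal.Quotient.eq, hs]

/-- Both sides bound dim E/J^N, J = (F). Monomials of degree < dN in x stay independent because J^N
⊆ 𝔪^(dN); monomials of degree < N in F, with coefficients representing E/J, span. -/
theorem IsCoordinates.card_exponentsLT_le (hx : IsCoordinates K x)
    (hF : ∀ i, F i ∈ famIdeal x ^ d) [Module.Finite K (E ⧸ famIdeal F)] {N : ℕ} (hN : 1 ≤ d * N) :
    (exponentsLT n (d * N)).card ≤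
      (exponentsLT n N).card * Module.finrank K (E ⧸ famIdeal F) := by
  let J := famIdeal F
  obtain ⟨s, hs⟩ := (Ideal.Quotient.mkₐ K J).toLinearMap.exists_rightInverse_of_surjective
    (LinearMap.range_eq_top.2 Ideal.Quotient.mk_surjective)
  have hs' : ∀ y, Ideal.Quotient.mk J (s y) = y := fun y => LinearMap.congr_fun hs y
  let Φ : (exponentsLT n N → E ⧸ J) →ₗ[K] E ⧸ J ^ N :=
    (Ideal.Quotient.mkₐ K (J ^ N)).toLinearMap ∘ₗ
      ∑ m : exponentsLT n N, LinearMap.mulLeft K (∏ i, F i ^ m.1 i) ∘ₗ s ∘ₗ LinearMap.proj m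
  have hΦ : Function.Surjective Φ := by
    intro z
    obtain ⟨φ, rfl⟩ := Ideal.Quotient.mk_surjective z
    obtain ⟨y, hy⟩ := exists_sub_sum_mem_pow hs' N φ
    refine ⟨fun m => y m, ?_⟩
    rw [← Finset.sum_coe_sort] at hy
    refine Eq.trans ?_ (Ideal.Quotient.eq.2 hy).symm
    simp [Φ, J]
  have hfin : Module.Finite K (E ⧸ J ^ N) := Module.Finite.of_surjective Φ hΦ
  have hle := LinearMap.finrank_le_finrank_of_surjective hΦ
  rw [Module.finrank_pi_fintype, Finset.sum_const, Finset.card_univ, Fintype.card_coe,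
    smul_eq_mul] at hle
  refine le_trans ?_ hle
  have hJ : J ^ N ≤ famIdeal x ^ (d * N) := by
    rw [pow_mul]
    exact Ideal.pow_right_mono (Ideal.span_le.2 (by rintro _ ⟨i, rfl⟩; exact hF i)) N
  have hli : LinearIndependent K fun m : exponentsLT n (d * N) =>
      Ideal.Quotient.mkₐ K (J ^ N) (aeval x (monomial m.1 (1 : K))) := by
    rw [Fintype.linearIndependent_iff]
    intro g hg m₀
    let p : MvPolynomial (Fin n) K := ∑ m : exponentsLT n (d * N), monomial m.1 (g m)
    have hp : aeval x p ∈ famIdeal x ^ (d * N - 1 + 1) := by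
      rw [Nat.sub_add_cancel hN]
      refine hJ (Ideal.Quotient.eq_zero_iff_mem.1 (Eq.trans ?_ hg))
      change Ideal.Quotient.mkₐ K (J ^ N) (aeval x p) = _
      simp only [p, map_sum]
      refine Finset.sum_congr rfl fun m _ => ?_
      rw [← map_smul, ← map_smul, smul_monomial, smul_eq_mul, mul_one]
    have hm₀ := mem_exponentsLT.1 m₀.2
    have h1 := hx.homogeneousComponent_eq_zero_of_aeval_mem hp m₀.1.degree (by omega)
    have h2 := congrArg (coeff m₀.1) h1
    rw [coeff_homogeneousComponent, if_pos rfl] at h2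
    simpa [p, coeff_sum, coeff_monomial, Subtype.coe_inj] using h2
  simpa using hli.fintype_card_le_finrank

/-- The two monomial counts, up to the factor n!, give (dN)^n ≤ D (N + n)^n; dividing by N^n and
letting N → ∞ removes the error. -/
theorem IsCoordinates.pow_le_finrank (hx : IsCoordinates K x) (hd : d ≠ 0)
    (hF : ∀ i, F i ∈ famIdeal x ^ d) [Module.Finite K (E ⧸ famIdeal F)] :
    d ^ n ≤ Module.finrank K (E ⧸ famIdeal F) := by
  set D := Module.finrank K (E ⧸ famIdeal F)
  have key : ∀ N : ℕ, 1 ≤ N → (d * N) ^ n ≤ D * (N + n) ^ n := by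
    intro N hN
    have hdN : 1 ≤ d * N := Nat.mul_pos (Nat.pos_of_ne_zero hd) hN
    calc (d * N) ^ n ≤ n.factorial * (exponentsLT n (d * N)).card := pow_le_card_exponentsLT n hdN
      _ ≤ n.factorial * ((exponentsLT n N).card * D) :=
        Nat.mul_le_mul_left _ (hx.card_exponentsLT_le hF hdN)
      _ = D * (n.factorial * (exponentsLT n N).card) := by ring
      _ ≤ D * (N + n) ^ n := Nat.mul_le_mul_left _ (card_exponentsLT_le_pow n hN)
  have hlim : Tendsto (fun N : ℕ => (D : ℝ) * (1 + (n : ℝ) / (N : ℝ)) ^ n) atTop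
      (𝓝 ((D : ℝ) * (1 + 0) ^ n)) :=
    ((tendsto_const_nhds.add (tendsto_const_div_atTop_nhds_zero_nat (n : ℝ))).pow n).const_mul _
  have h := ge_of_tendsto (b := (d : ℝ) ^ n) hlim (by
    filter_upwards [eventually_ge_atTop 1] with N hN
    have hN0 : (0 : ℝ) < N := by exact_mod_cast hN
    have h1 : ((d : ℝ) * N) ^ n ≤ D * ((N : ℝ) + n) ^ n := by exact_mod_cast key N hN
    rw [one_add_div hN0.ne', div_pow, ← mul_div_assoc, le_div_iff₀ (by positivity), ← mul_pow]
    exact h1)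
  rw [add_zero, one_pow, mul_one] at h
  exact_mod_cast h

/-- If the leading forms `P i`, of degree `d`, of `n` elements `F i` of a local algebra with `n`
coordinates generate an ideal of finite codimension, then the ideal generated by the `F i` has
codimension `d ^ n`. -/
theorem IsCoordinates.finrank_quotient_eq_pow [Infinite K] (hx : IsCoordinates K x) (hn : n ≠ 0)
    {P : Fin n → MvPolynomial (Fin n) K} (hP : ∀ i, (P i).IsHomogeneous d)
    (hF : ∀ i, F i - aeval x (P i) ∈ famIdeal x ^ (d + 1))
    (hfin : Module.Finite K (E ⧸ famIdeal fun i => aeval x (P i))) :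
    Module.Finite K (E ⧸ famIdeal F) ∧ Module.finrank K (E ⧸ famIdeal F) = d ^ n := by
  obtain ⟨k, hk⟩ := hx.exists_forall_mem hP hfin
  obtain ⟨hfinF, hle⟩ := hx.finite_finrank_le hP hF hk
  refine ⟨hfinF, ?_⟩
  -- For d = 0 the Pᵢ are constants, not all zero, so some Fᵢ is a unit and the codimension is 0 =
  -- 0^n; here n ≠ 0 matters.
  rcases eq_or_ne d 0 with rfl | hd
  · have hex : ∃ i, P i ≠ 0 := by
      by_contra! h
      have h1 := hk (X ⟨0, Nat.pos_of_ne_zero hn⟩ ^ k) (isHomogeneous_X_pow _ k)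
      have h2 : famIdeal P = ⊥ := by
        rw [Ideal.span_eq_bot]
        rintro _ ⟨i, rfl⟩
        exact h i
      rw [h2, Ideal.mem_bot] at h1
      exact pow_ne_zero k (X_ne_zero _) h1
    obtain ⟨i, hi⟩ := hex
    obtain ⟨c, hc⟩ : ∃ c, P i = C c :=
      ⟨_, totalDegree_eq_zero_iff_eq_C.1 ((totalDegree_zero_iff_isHomogeneous _).2 (hP i))⟩
    have hFi := hF i
    rw [hc, aeval_C, zero_add, pow_one] at hFi
    have hu := hx.isUnit_of_const_ne_zero (by rintro rfl; simp [hc] at hi) hFi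
    have htop : famIdeal F = ⊤ := Ideal.eq_top_of_isUnit_mem _ (Ideal.subset_span ⟨i, rfl⟩) hu
    have : Subsingleton (E ⧸ famIdeal F) := Ideal.Quotient.subsingleton_iff.2 htop
    rw [Module.finrank_zero_of_subsingleton, zero_pow hn]
  · refine le_antisymm ?_ (hx.pow_le_finrank hd fun i => ?_)
    · exact_mod_cast hle.trans (sum_hilbertFun_span_le hd hP hk k)
    · rw [← sub_add_cancel (F i) (aeval x (P i))]
      exact Ideal.add_mem _ (Ideal.pow_le_pow_right (Nat.le_succ d) (hF i)) (aeval_mem_pow x (hP i))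

end LowerBound

/-! ### Smooth dependence of integrals on parameters and Hadamard's lemma -/

section Hadamard

theorem hasFDerivAt_intervalIntegral {H E : Type*} [NormedAddCommGroup H] [NormedSpace ℝ H]
    [FiniteDimensional ℝ H] [NormedAddCommGroup E] [NormedSpace ℝ E]
    {f : H × ℝ → E} (hf : ContDiff ℝ 1 f) (x₀ : H) :
    HasFDerivAt (fun x => ∫ t in (0 : ℝ)..1, f (x, t))
      (∫ t in (0 : ℝ)..1, (fderiv ℝ f (x₀, t)).comp (ContinuousLinearMap.inl ℝ H ℝ)) x₀ := by
  have : ProperSpace H := FiniteDimensional.proper_real H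
  have hf' : Continuous fun p : H × ℝ => (fderiv ℝ f p).comp (ContinuousLinearMap.inl ℝ H ℝ) :=
    (hf.continuous_fderiv one_ne_zero).clm_comp continuous_const
  obtain ⟨C, hC⟩ := ((isCompact_closedBall x₀ 1).prod (isCompact_Icc (a := (0 : ℝ)) (b := 1))
    ).exists_bound_of_continuousOn hf'.continuousOn
  have hcont : ∀ x, Continuous fun t : ℝ => f (x, t) := fun x =>
    hf.continuous.comp (by fun_prop)
  refine intervalIntegral.hasFDerivAt_integral_of_dominated_of_fderiv_le
    (F := fun x t => f (x, t))
    (F' := fun x t => (fderiv ℝ f (x, t)).comp (ContinuousLinearMap.inl ℝ H ℝ))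
    (bound := fun _ => C) (Metric.closedBall_mem_nhds x₀ one_pos)
    (Eventually.of_forall fun x => (hcont x).aestronglyMeasurable)
    ((hcont x₀).intervalIntegrable _ _)
    (Continuous.aestronglyMeasurable (hf'.comp (by fun_prop)))
    (Eventually.of_forall fun t ht x hx => hC (x, t) ⟨hx, ?_⟩)
    intervalIntegrable_const
    (Eventually.of_forall fun t _ x _ => ?_)
  · rw [Set.uIoc_of_le zero_le_one] at ht
    exact ⟨ht.1.le, ht.2⟩
  · have h1 := (hf.differentiable one_ne_zero (x, t)).hasFDerivAt
    exact h1.comp x ((hasFDerivAt_id x).prodMk (hasFDerivAt_const t x))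

/-- Induction by differentiating under the integral sign. The target `E` varies in the induction
because the derivative takes values in `H →L[ℝ] E`. -/
theorem contDiff_intervalIntegral_nat {H : Type} [NormedAddCommGroup H] [NormedSpace ℝ H]
    [FiniteDimensional ℝ H] (k : ℕ) : ∀ {E : Type} [NormedAddCommGroup E] [NormedSpace ℝ E]
    {f : H × ℝ → E}, ContDiff ℝ ∞ f → ContDiff ℝ k fun x => ∫ t in (0 : ℝ)..1, f (x, t) := by
  induction k with
  | zero =>
    intro E _ _ f hf
    have := intervalIntegral.continuous_parametric_intervalIntegral_of_continuous'
      (μ := MeasureTheory.volume) (f := fun x t => f (x, t)) hf.continuous 0 1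
    simpa using this
  | succ k ih =>
    intro E _ _ f hf
    push_cast
    rw [contDiff_succ_iff_hasFDerivAt]
    refine ⟨_, ih (f := fun p => (fderiv ℝ f p).comp (ContinuousLinearMap.inl ℝ H ℝ)) ?_,
      fun x => hasFDerivAt_intervalIntegral (hf.of_le (by exact_mod_cast le_top)) x⟩
    exact (hf.fderiv_right (by simp)).clm_comp contDiff_const

theorem contDiff_intervalIntegral {H E : Type} [NormedAddCommGroup H] [NormedSpace ℝ H]
    [FiniteDimensional ℝ H] [NormedAddCommGroup E] [NormedSpace ℝ E]
    {f : H × ℝ → E} (hf : ContDiff ℝ ∞ f) :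
    ContDiff ℝ ∞ fun x => ∫ t in (0 : ℝ)..1, f (x, t) :=
  contDiff_infty.2 fun k => contDiff_intervalIntegral_nat k hf

variable {n : ℕ}

theorem fderiv_apply_eq_sum (F : Eucl n → ℝ) (y x : Eucl n) :
    fderiv ℝ F y x = ∑ i, x i * partialFun i F y := by
  have hx : x = ∑ i, x i • EuclideanSpace.single i (1 : ℝ) := by
    ext j
    simp [Pi.single_apply]
  conv_lhs => rw [hx]
  simp [partialFun]

theorem contDiff_partialFun {F : Eucl n → ℝ} (hF : ContDiff ℝ ∞ F) (i : Fin n) :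
    ContDiff ℝ ∞ (partialFun i F) :=
  (hF.fderiv_right (by simp)).clm_apply contDiff_const

/-- Hadamard's lemma. -/
theorem exists_eq_add_sum_mul {F : Eucl n → ℝ} (hF : ContDiff ℝ ∞ F) :
    ∃ G : Fin n → Eucl n → ℝ, (∀ i, ContDiff ℝ ∞ (G i)) ∧
      ∀ x, F x = F 0 + ∑ i, x i * G i x := by
  refine ⟨fun i x => ∫ t in (0 : ℝ)..1, partialFun i F (t • x), fun i => ?_, fun x => ?_⟩
  · exact contDiff_intervalIntegral (f := fun p : Eucl n × ℝ => partialFun i F (p.2 • p.1))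
      ((contDiff_partialFun hF i).comp (contDiff_snd.smul contDiff_fst))
  · have hcont : ∀ i, Continuous fun t : ℝ => partialFun i F (t • x) := fun i =>
      (contDiff_partialFun hF i).continuous.comp (by fun_prop)
    have hderiv : ∀ t : ℝ, HasDerivAt (fun t : ℝ => F (t • x)) (fderiv ℝ F (t • x) x) t := by
      intro t
      have h1 := (hF.differentiable (by simp) (t • x)).hasFDerivAt
      have h2 : HasDerivAt (fun t : ℝ => t • x) x t := by
        simpa using (hasDerivAt_id t).smul_const x
      exact h1.comp_hasDerivAt t h2
    have hint := intervalIntegral.integral_eq_sub_of_hasDerivAt (a := 0) (b := 1)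
      (fun t _ => hderiv t) (by
        refine Continuous.intervalIntegrable ?_ _ _
        simp_rw [fderiv_apply_eq_sum]
        exact continuous_finsetSum _ fun i _ => continuous_const.mul (hcont i))
    simp_rw [fderiv_apply_eq_sum] at hint
    rw [intervalIntegral.integral_finsetSum fun i _ =>
      ((hcont i).const_mul (x i)).intervalIntegrable _ _] at hint
    simp only [intervalIntegral.integral_const_mul, one_smul, zero_smul] at hint
    rw [hint]; ring

end Hadamard

/-! ### Representatives of smooth germs -/

section Germs

variable {n : ℕ}

/-- The germ at the origin of a smooth function. -/
def germOf (F : Eucl n → ℝ) (hF : ContDiff ℝ ∞ F) : SmoothGerm n :=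
  ⟨(F : Germ (𝓝 (0 : Eucl n)) ℝ), F, ⟨Set.univ, isOpen_univ, trivial, hF.contDiffOn⟩, rfl⟩

/-- A bump function supported where the germ is smooth supplies a globally smooth representative, on
which derivatives and integrals need no domain conditions. -/
theorem exists_germOf_eq (φ : SmoothGerm n) : ∃ F, ∃ hF : ContDiff ℝ ∞ F, germOf F hF = φ := by
  obtain ⟨_, F, ⟨U, hU, h0, hF⟩, rfl⟩ := φ
  obtain ⟨r, hr, hrU⟩ := Metric.nhds_basis_closedBall.mem_iff.1 (hU.mem_nhds h0)
  let χ : ContDiffBump (0 : Eucl n) := ⟨r / 2, r, half_pos hr, half_lt_self hr⟩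
  have hsmooth : ContDiff ℝ ∞ fun x => χ x * F x := by
    rw [contDiff_iff_contDiffAt]
    intro x
    by_cases hx : x ∈ U
    · exact χ.contDiff.contDiffAt.mul (hF.contDiffAt (hU.mem_nhds hx))
    · have hx' : x ∉ tsupport χ := fun h => hx (hrU (by rwa [χ.tsupport_eq] at h))
      refine (contDiffAt_const (c := (0 : ℝ))).congr_of_eventuallyEq ?_
      filter_upwards [notMem_tsupport_iff_eventuallyEq.1 hx'] with y hy
      simp [hy]
  refine ⟨_, hsmooth, Subtype.ext (Germ.coe_eq.2 ?_)⟩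
  filter_upwards [χ.eventuallyEq_one] with x hx
  simp [hx]

/-- The germ of the `i`-th coordinate function. -/
def coord (i : Fin n) : SmoothGerm n := germOf (fun x => x i) (by fun_prop)

theorem coe_aeval_coord (p : MvPolynomial (Fin n) ℝ) :
    (MvPolynomial.aeval coord p : SmoothGerm n).1 =
      ((fun x : Eucl n => MvPolynomial.eval x p : Eucl n → ℝ) : Germ (𝓝 (0 : Eucl n)) ℝ) := by
  induction p using MvPolynomial.induction_on with
  | C a =>
    rw [MvPolynomial.aeval_C]
    simp only [MvPolynomial.eval_C]
    change algebraMap ℝ (Germ (𝓝 (0 : Eucl n)) ℝ) a = _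
    rw [Algebra.algebraMap_eq_smul_one]
    refine congrArg (fun F : Eucl n → ℝ => (F : Germ (𝓝 (0 : Eucl n)) ℝ))
      (?_ : a • (1 : Eucl n → ℝ) = _)
    ext; simp
  | add p q hp hq =>
    rw [map_add, AddMemClass.coe_add, hp, hq]
    simp only [map_add]
    rfl
  | mul_X p i hp =>
    rw [map_mul, MulMemClass.coe_mul, hp, MvPolynomial.aeval_X]
    simp only [map_mul, MvPolynomial.eval_X]
    rfl

theorem value_eq_zero_of_mem {φ : SmoothGerm n} (h : φ ∈ famIdeal (coord (n := n))) : φ.1.value = 0 := by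
  have hle : famIdeal (coord (n := n)) ≤
      RingHom.ker ((Germ.valueRingHom (E := ℝ) (x := (0 : Eucl n))).comp
        (SmoothGerm n).val.toRingHom) := by
    refine Ideal.span_le.2 ?_
    rintro _ ⟨i, rfl⟩
    exact (rfl : (0 : Eucl n) i = 0)
  exact hle h

theorem isUnit_of_value_ne_zero {φ : SmoothGerm n} (h : φ.1.value ≠ 0) : IsUnit φ := by
  obtain ⟨F, hF, rfl⟩ := exists_germOf_eq φ
  have h0 : F 0 ≠ 0 := h
  have hU : IsOpen {x | F x ≠ 0} := isOpen_ne_fun hF.continuous continuous_const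
  let ψ : SmoothGerm n := ⟨((fun x => (F x)⁻¹ : Eucl n → ℝ) : Germ (𝓝 (0 : Eucl n)) ℝ), _,
    ⟨_, hU, h0, fun x hx => (hF.contDiffAt.inv hx).contDiffWithinAt⟩, rfl⟩
  refine IsUnit.of_mul_eq_one ψ (Subtype.ext (Germ.coe_eq.2 ?_))
  filter_upwards [hU.mem_nhds h0] with x hx
  exact mul_inv_cancel₀ hx

/-- For φ ∈ 𝔪 the germ φψ + 1 has value 1 at the origin, hence a smooth reciprocal near it. -/
theorem coord_le_jacobson : famIdeal (coord (n := n)) ≤ Ideal.jacobson ⊥ := by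
  intro φ hφ
  rw [Ideal.mem_jacobson_bot]
  intro ψ
  apply isUnit_of_value_ne_zero
  have h1 := value_eq_zero_of_mem (Ideal.mul_mem_right ψ _ hφ)
  have h2 : (φ * ψ + 1 : SmoothGerm n).1.value = (φ * ψ : SmoothGerm n).1.value + 1 :=
    map_add (Germ.valueRingHom (E := ℝ) (x := (0 : Eucl n))) (φ * ψ).1 1
  rw [h2, h1]
  norm_num

theorem exists_sub_algebraMap_mem (φ : SmoothGerm n) :
    ∃ c : ℝ, φ - algebraMap ℝ (SmoothGerm n) c ∈ famIdeal (coord (n := n)) := by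
  obtain ⟨F, hF, rfl⟩ := exists_germOf_eq φ
  obtain ⟨G, hG, hFG⟩ := exists_eq_add_sum_mul hF
  refine ⟨F 0, ?_⟩
  have : germOf F hF - algebraMap ℝ (SmoothGerm n) (F 0) = ∑ i, germOf (G i) (hG i) * coord i := by
    rw [sub_eq_iff_eq_add']
    refine Subtype.ext ?_
    have h1 := coe_aeval_coord (n := n) (MvPolynomial.C (F 0))
    rw [MvPolynomial.aeval_C] at h1
    rw [AddMemClass.coe_add, AddSubmonoidClass.coe_finsetSum, h1]
    have h2 : ∀ i, ((germOf (G i) (hG i) * coord i : SmoothGerm n) : Germ (𝓝 (0 : Eucl n)) ℝ) =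
      Germ.coeRingHom (𝓝 (0 : Eucl n)) (fun x : Eucl n => x i * G i x) := fun i =>
        congrArg _ (funext fun x : Eucl n => mul_comm (G i x) (x i))
    simp_rw [h2]
    rw [← map_sum]
    refine congrArg (Germ.coeRingHom (𝓝 (0 : Eucl n))) (funext fun x => ?_ :
      F = (fun x : Eucl n => MvPolynomial.eval x (MvPolynomial.C (F 0))) +
        ∑ i, fun x : Eucl n => x i * G i x)
    simp [hFG x]
  rw [this]
  exact Ideal.sum_mem _ fun i _ => Ideal.mul_mem_left _ _ (Ideal.subset_span ⟨i, rfl⟩)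

open Asymptotics in
/-- The ideal of germs that are `O(‖x‖ ^ j)`. -/
def bigOIdeal (n j : ℕ) : Ideal (SmoothGerm n) where
  carrier := {φ | ∃ F : Eucl n → ℝ, (F : Germ (𝓝 (0 : Eucl n)) ℝ) = φ.1 ∧
    F =O[𝓝 0] fun x => ‖x‖ ^ j}
  add_mem' := by
    rintro φ ψ ⟨F, hF, hFO⟩ ⟨G, hG, hGO⟩
    exact ⟨F + G, by rw [AddMemClass.coe_add, ← hF, ← hG]; rfl, hFO.add hGO⟩
  zero_mem' := ⟨0, rfl, isBigO_zero _ _⟩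
  smul_mem' := by
    rintro φ ψ ⟨G, hG, hGO⟩
    obtain ⟨F, hF, rfl⟩ := exists_germOf_eq φ
    refine ⟨fun x => F x * G x, by rw [smul_eq_mul, MulMemClass.coe_mul, ← hG]; rfl, ?_⟩
    have h1 : F =O[𝓝 0] fun _ => (1 : ℝ) := hF.continuous.continuousAt.isBigO_one ℝ
    simpa using h1.mul hGO

open Asymptotics in
theorem isBigO_of_mem_bigOIdeal {j : ℕ} {φ : SmoothGerm n} (h : φ ∈ bigOIdeal n j)
    {F : Eucl n → ℝ} (hF : (F : Germ (𝓝 (0 : Eucl n)) ℝ) = φ.1) :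
    F =O[𝓝 0] fun x => ‖x‖ ^ j := by
  obtain ⟨G, hG, hGO⟩ := h
  exact hGO.congr' (Germ.coe_eq.1 (hG.trans hF.symm)) EventuallyEq.rfl

open Asymptotics in
theorem pow_coord_le_bigOIdeal (j : ℕ) : famIdeal (coord (n := n)) ^ j ≤ bigOIdeal n j := by
  induction j with
  | zero =>
    intro φ _
    obtain ⟨F, hF, rfl⟩ := exists_germOf_eq φ
    exact ⟨F, rfl, by simpa using hF.continuous.continuousAt.isBigO_one ℝ⟩
  | succ j ih =>
    rw [pow_succ, Ideal.mul_le]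
    intro φ hφ ψ hψ
    have hψ1 : ψ ∈ bigOIdeal n 1 := by
      refine (Ideal.span_le.2 ?_ : famIdeal coord ≤ bigOIdeal n 1) hψ
      rintro _ ⟨i, rfl⟩
      refine ⟨fun x => x i, rfl, IsBigO.of_bound 1 (Eventually.of_forall fun x => ?_)⟩
      simpa using PiLp.norm_apply_le x i
    obtain ⟨F, hF, hFO⟩ := ih hφ
    obtain ⟨G, hG, hGO⟩ := hψ1
    refine ⟨fun x => F x * G x, by rw [MulMemClass.coe_mul, ← hF, ← hG]; rfl, ?_⟩
    simpa [pow_succ] using hFO.mul hGO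

end Germs

/-! ### Polynomials vanishing to high order -/

section Order

open Asymptotics

theorem polynomial_eq_zero_of_isLittleO {K : ℕ} : ∀ {q : Polynomial ℝ}, q.natDegree ≤ K →
    (fun t => q.eval t) =o[𝓝[>] 0] (fun t : ℝ => t ^ K) → q = 0 := by
  induction K with
  | zero =>
    intro q hq h
    rw [Polynomial.eq_C_of_natDegree_le_zero hq] at h ⊢
    simp only [Polynomial.eval_C, pow_zero, isLittleO_const_const_iff] at h
    simpa using h
  | succ K ih =>
    intro q hq h
    have h1 : Tendsto (fun t => q.eval t) (𝓝[>] 0) (𝓝 0) := by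
      refine h.trans_tendsto ?_
      have : Tendsto (fun t : ℝ => t ^ (K + 1)) (𝓝 0) (𝓝 (0 ^ (K + 1))) :=
        (continuous_pow (K + 1)).tendsto 0
      rw [zero_pow (Nat.succ_ne_zero K)] at this
      exact this.mono_left nhdsWithin_le_nhds
    have h2 : Tendsto (fun t => q.eval t) (𝓝[>] 0) (𝓝 (q.eval 0)) :=
      (q.continuous.tendsto 0).mono_left nhdsWithin_le_nhds
    have h3 : q.eval 0 = 0 := tendsto_nhds_unique h2 h1
    obtain ⟨r, rfl⟩ := Polynomial.X_dvd_iff.2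
      ((Polynomial.coeff_zero_eq_eval_zero q).trans h3)
    rw [ih (q := r) ?_ ?_, mul_zero]
    · by_cases hr : r = 0
      · simp [hr]
      · rw [Polynomial.natDegree_X_mul hr] at hq
        omega
    · have h4 : (fun t : ℝ => t⁻¹ * (Polynomial.X * r).eval t) =o[𝓝[>] 0]
          fun t : ℝ => t⁻¹ * t ^ (K + 1) := (isBigO_refl _ _).mul_isLittleO h
      refine h4.congr' ?_ ?_ <;> filter_upwards [self_mem_nhdsWithin] with t ht
      · rw [Polynomial.eval_mul, Polynomial.eval_X, inv_mul_cancel_left₀ (ne_of_gt ht)]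
      · rw [pow_succ', inv_mul_cancel_left₀ (ne_of_gt ht)]

/-- A power `c t ^ α` that agrees up to `o(t ^ K)` with a polynomial, `α ≤ K`, is a monomial. -/
theorem eq_monomial_of_isLittleO {K : ℕ} {α c : ℝ} {q : Polynomial ℝ} (hα : α ≤ K)
    (hq : q.natDegree ≤ K)
    (h : (fun t : ℝ => c * t ^ α - q.eval t) =o[𝓝[>] 0] (fun t : ℝ => t ^ K)) :
    (c = 0 ∧ q = 0) ∨ ∃ m : ℕ, (m : ℝ) = α ∧ q = Polynomial.monomial m c := by
  have hscale : Tendsto (fun t : ℝ => 2 * t) (𝓝[>] 0) (𝓝[>] 0) := by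
    refine tendsto_nhdsWithin_iff.2 ⟨?_, ?_⟩
    · have : Tendsto (fun t : ℝ => 2 * t) (𝓝 0) (𝓝 (2 * 0)) := (continuous_const_mul 2).tendsto 0
      rw [mul_zero] at this
      exact this.mono_left nhdsWithin_le_nhds
    · filter_upwards [self_mem_nhdsWithin] with t ht
      exact mul_pos two_pos (Set.mem_Ioi.1 ht)
  have h2 : (fun t : ℝ => c * (2 * t) ^ α - q.eval (2 * t)) =o[𝓝[>] 0] (fun t : ℝ => t ^ K) := by
    refine (h.comp_tendsto hscale).trans_isBigO ?_
    refine IsBigO.of_bound (2 ^ K) (Eventually.of_forall fun t => ?_)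
    simp [mul_pow]
  -- Comparing t with 2t eliminates c t^α: the polynomial q(2t) - 2^α q(t) is o(t^K) of degree ≤ K,
  -- hence zero, so (2^e - 2^α) qₑ = 0 and only the exponent e = α survives.
  let r : Polynomial ℝ := q.comp (Polynomial.C 2 * Polynomial.X) - Polynomial.C ((2 : ℝ) ^ α) * q
  have hr : r = 0 := by
    apply polynomial_eq_zero_of_isLittleO (K := K)
    · refine (Polynomial.natDegree_sub_le _ _).trans (max_le ?_ ?_)
      · refine Polynomial.natDegree_comp_le.trans ?_
        rwa [Polynomial.natDegree_C_mul_X 2 two_ne_zero, mul_one]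
      · exact (Polynomial.natDegree_C_mul_le _ _).trans hq
    · have h3 := (h.const_mul_left ((2 : ℝ) ^ α)).sub h2
      refine h3.congr' ?_ EventuallyEq.rfl
      filter_upwards [self_mem_nhdsWithin] with t ht
      rw [Real.mul_rpow zero_le_two (le_of_lt ht)]
      simp [r]
      ring
  have hcoeff : ∀ e : ℕ, (e : ℝ) ≠ α → q.coeff e = 0 := by
    intro e he
    have h3 := congrArg (fun p => Polynomial.coeff p e) hr
    simp only [r, Polynomial.coeff_sub, Polynomial.coeff_C_mul, Polynomial.coeff_zero,
      Polynomial.comp_C_mul_X_coeff] at h3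
    have h4 : (2 : ℝ) ^ e ≠ (2 : ℝ) ^ α := by
      rw [← Real.rpow_natCast]
      intro h
      exact he ((Real.rpow_right_inj two_pos (by norm_num)).1 h)
    have h5 : ((2 : ℝ) ^ e - (2 : ℝ) ^ α) * q.coeff e = 0 := by linarith
    exact (mul_eq_zero.1 h5).resolve_left (sub_ne_zero.2 h4)
  have hpow : (fun t : ℝ => t ^ K) =O[𝓝[>] 0] fun t : ℝ => t ^ α := by
    refine IsBigO.of_bound 1 ?_
    filter_upwards [Ioo_mem_nhdsGT one_pos] with t ht
    rw [one_mul, Real.norm_of_nonneg (by have := ht.1.le; positivity),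
      Real.norm_of_nonneg (Real.rpow_nonneg ht.1.le _), ← Real.rpow_natCast]
    exact Real.rpow_le_rpow_of_exponent_ge ht.1 ht.2.le hα
  have hzero : ∀ a : ℝ, (∀ t : ℝ, 0 < t → q.eval t = a * t ^ α) → c = a := by
    intro a ha
    have h3 : (fun t : ℝ => (c - a) * t ^ α) =o[𝓝[>] 0] fun t : ℝ => t ^ α := by
      refine (h.congr' ?_ EventuallyEq.rfl).trans_isBigO hpow
      filter_upwards [self_mem_nhdsWithin] with t ht
      rw [ha t ht]; ring
    by_contra hne
    have h4 : (fun t : ℝ => t ^ α) =o[𝓝[>] 0] fun t : ℝ => t ^ α :=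
      (isLittleO_const_mul_left_iff (sub_ne_zero.2 hne)).1 h3
    have h5 := isLittleO_irrefl (f'' := fun t : ℝ => t ^ α) (l := 𝓝[>] (0 : ℝ)) (by
      refine Eventually.frequently ?_
      filter_upwards [self_mem_nhdsWithin] with t ht
      exact (Real.rpow_pos_of_pos ht α).ne')
    exact h5 h4
  by_cases hm : ∃ m : ℕ, (m : ℝ) = α
  · obtain ⟨m, hm⟩ := hm
    right
    have hq' : q = Polynomial.monomial m (q.coeff m) := by
      ext e
      rw [Polynomial.coeff_monomial]
      split_ifs with hme
      · rw [hme]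
      · exact hcoeff e fun he => hme (by exact_mod_cast (hm.trans he.symm))
    refine ⟨m, hm, ?_⟩
    rw [hzero (q.coeff m) fun t _ => ?_]
    · exact hq'
    · conv_lhs => rw [hq']
      rw [Polynomial.eval_monomial, ← hm, Real.rpow_natCast]
  · left
    have hq0 : q = 0 := by
      ext e
      exact hcoeff e fun he => hm ⟨e, he⟩
    exact ⟨hzero 0 fun t _ => by simp [hq0], hq0⟩

variable {n : ℕ}

theorem eval_smul_of_isHomogeneous {m : ℕ} {p : MvPolynomial (Fin n) ℝ} (hp : p.IsHomogeneous m)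
    (t : ℝ) (v : Eucl n) :
    MvPolynomial.eval (t • v : Eucl n) p = t ^ m * MvPolynomial.eval v p := by
  rw [MvPolynomial.eval_eq', MvPolynomial.eval_eq', Finset.mul_sum]
  refine Finset.sum_congr rfl fun s hs => ?_
  have hdeg : s.degree = m := by
    by_contra h
    exact MvPolynomial.mem_support_iff.1 hs (hp.coeff_eq_zero h)
  have : ∏ i, (t • v : Eucl n) i ^ s i = t ^ m * ∏ i, v i ^ s i := by
    simp only [PiLp.smul_apply, smul_eq_mul, mul_pow, Finset.prod_mul_distrib]
    rw [Finset.prod_pow_eq_pow_sum, ← hdeg, Finsupp.degree_eq_sum]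
  rw [this]; ring

/-- The restriction of a polynomial of degree at most `K` to the line through `v`. -/
def linePoly (K : ℕ) (p : MvPolynomial (Fin n) ℝ) (v : Eucl n) : Polynomial ℝ :=
  ∑ j ∈ Finset.range (K + 1),
    Polynomial.monomial j (MvPolynomial.eval v (MvPolynomial.homogeneousComponent j p))

theorem coeff_linePoly {K j : ℕ} (hj : j ≤ K) (p : MvPolynomial (Fin n) ℝ) (v : Eucl n) :
    (linePoly K p v).coeff j = MvPolynomial.eval v (MvPolynomial.homogeneousComponent j p) := by
  simp [linePoly, Polynomial.coeff_monomial, Nat.lt_succ_of_le hj]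

theorem natDegree_linePoly_le (K : ℕ) (p : MvPolynomial (Fin n) ℝ) (v : Eucl n) :
    (linePoly K p v).natDegree ≤ K :=
  Polynomial.natDegree_sum_le_of_forall_le _ _ fun _ hj =>
    (Polynomial.natDegree_monomial_le _).trans (Nat.lt_succ_iff.1 (Finset.mem_range.1 hj))

theorem sum_range_homogeneousComponent {K : ℕ} {p : MvPolynomial (Fin n) ℝ}
    (hp : p.totalDegree ≤ K) :
    ∑ j ∈ Finset.range (K + 1), MvPolynomial.homogeneousComponent j p = p := by
  conv_rhs => rw [← MvPolynomial.sum_homogeneousComponent p]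
  refine (Finset.sum_subset (Finset.range_mono (by omega)) fun i _ hi => ?_).symm
  exact MvPolynomial.homogeneousComponent_eq_zero _ _ (by simp at hi; omega)

theorem eval_linePoly {K : ℕ} {p : MvPolynomial (Fin n) ℝ} (hp : p.totalDegree ≤ K) (v : Eucl n)
    (t : ℝ) : (linePoly K p v).eval t = MvPolynomial.eval (t • v : Eucl n) p := by
  conv_rhs => rw [← sum_range_homogeneousComponent hp, map_sum]
  simp only [linePoly, Polynomial.eval_finsetSum, Polynomial.eval_monomial]
  refine Finset.sum_congr rfl fun j _ => ?_
  rw [eval_smul_of_isHomogeneous (MvPolynomial.homogeneousComponent_isHomogeneous j p), mul_comm]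

theorem tendsto_smul_nhdsGT (v : Eucl n) : Tendsto (fun t : ℝ => t • v) (𝓝[>] 0) (𝓝 0) := by
  have : Tendsto (fun t : ℝ => t • v) (𝓝 0) (𝓝 ((0 : ℝ) • v)) :=
    (continuous_id.smul continuous_const).tendsto 0
  rw [zero_smul] at this
  exact this.mono_left nhdsWithin_le_nhds

theorem isLittleO_line {K : ℕ} {H : Eucl n → ℝ} (h : H =o[𝓝 0] fun x => ‖x‖ ^ K) (v : Eucl n) :
    (fun t : ℝ => H (t • v)) =o[𝓝[>] 0] fun t : ℝ => t ^ K := by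
  refine (h.comp_tendsto (tendsto_smul_nhdsGT v)).trans_isBigO ?_
  refine IsBigO.of_bound (‖v‖ ^ K) (Eventually.of_forall fun t => ?_)
  simp [norm_smul, mul_pow, mul_comm]

theorem isLittleO_of_isBigO_succ {K : ℕ} {H : Eucl n → ℝ}
    (h : H =O[𝓝 0] fun x => ‖x‖ ^ (K + 1)) : H =o[𝓝 0] fun x => ‖x‖ ^ K := by
  refine h.trans_isLittleO ?_
  have h1 : (fun x : Eucl n => ‖x‖) =o[𝓝 0] fun _ => (1 : ℝ) := by
    rw [isLittleO_one_iff]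
    simpa using (continuous_norm (E := Eucl n)).tendsto 0
  simpa [pow_succ] using (isBigO_refl (fun x : Eucl n => ‖x‖ ^ K) (𝓝 0)).mul_isLittleO h1

theorem mvPolynomial_eq_of_eval {p q : MvPolynomial (Fin n) ℝ}
    (h : ∀ v : Eucl n, MvPolynomial.eval v p = MvPolynomial.eval v q) : p = q :=
  MvPolynomial.funext fun v => h (WithLp.toLp 2 v)

/-- On each line through the origin this is the statement in one variable. -/
theorem mvPolynomial_eq_zero_of_isLittleO {K : ℕ} {p : MvPolynomial (Fin n) ℝ}
    (hp : p.totalDegree ≤ K)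
    (h : (fun x : Eucl n => MvPolynomial.eval x p) =o[𝓝 0] fun x => ‖x‖ ^ K) : p = 0 := by
  refine mvPolynomial_eq_of_eval fun v => ?_
  have h1 := isLittleO_line h v
  simp_rw [← eval_linePoly hp v] at h1
  have h2 := polynomial_eq_zero_of_isLittleO (natDegree_linePoly_le K p v) h1
  have h3 := eval_linePoly hp v 1
  rw [h2, one_smul] at h3
  simpa using h3.symm

/-- The coordinate germs satisfy the hypotheses of the algebraic theory. -/
theorem isCoordinates_coord : IsCoordinates ℝ (coord (n := n)) where
  exists_const := exists_sub_algebraMap_mem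
  eq_zero _ p hp h := mvPolynomial_eq_zero_of_isLittleO hp.totalDegree_le
    (isLittleO_of_isBigO_succ (isBigO_of_mem_bigOIdeal (pow_coord_le_bigOIdeal _ h)
      (coe_aeval_coord p).symm))
  le_jacobson := coord_le_jacobson

/-- Taylor expansion of smooth germs. -/
theorem exists_taylor {φ : SmoothGerm n} {F : Eucl n → ℝ}
    (hF : (F : Germ (𝓝 (0 : Eucl n)) ℝ) = φ.1) (k : ℕ) :
    ∃ p : MvPolynomial (Fin n) ℝ, p.totalDegree ≤ k ∧
      φ - MvPolynomial.aeval coord p ∈ famIdeal (coord (n := n)) ^ (k + 1) ∧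
      (fun x => F x - MvPolynomial.eval x p) =o[𝓝 0] fun x => ‖x‖ ^ k := by
  obtain ⟨p, hpk, hp⟩ := isCoordinates_coord.exists_poly φ k
  refine ⟨p, hpk, hp, isLittleO_of_isBigO_succ
    (isBigO_of_mem_bigOIdeal (pow_coord_le_bigOIdeal _ hp) ?_)⟩
  rw [AddSubgroupClass.coe_sub, coe_aeval_coord, ← hF]
  rfl

/-- A positively homogeneous function which is smooth at the origin is a form. -/
theorem exists_form_of_homogeneous {φ : SmoothGerm n} {G : Eucl n → ℝ}
    (hG : (G : Germ (𝓝 (0 : Eucl n)) ℝ) = φ.1) {α : ℝ≥0}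
    (hhom : ∀ (t : ℝ) (x : Eucl n), 0 < t → G (t • x) = t ^ (α : ℝ) * G x) (hne : ∃ v, G v ≠ 0) :
    ∃ (m : ℕ) (P : MvPolynomial (Fin n) ℝ), α = m ∧ P.IsHomogeneous m ∧
      ∀ v : Eucl n, G v = MvPolynomial.eval v P := by
  -- Along each line G is c t^α and agrees to order K ≥ α with its Taylor polynomial. A line with
  -- G(v) ≠ 0 makes α an integer m, and then G is the degree m component of that polynomial.
  obtain ⟨K, hK⟩ := exists_nat_ge (α : ℝ)
  obtain ⟨p, hpK, -, hpo⟩ := exists_taylor hG K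
  have key : ∀ v, (G v = 0 ∧ linePoly K p v = 0) ∨
      ∃ m : ℕ, (m : ℝ) = α ∧ linePoly K p v = Polynomial.monomial m (G v) := by
    intro v
    refine eq_monomial_of_isLittleO hK (natDegree_linePoly_le K p v) ?_
    refine (isLittleO_line hpo v).congr' ?_ EventuallyEq.rfl
    filter_upwards [self_mem_nhdsWithin] with t ht
    rw [hhom t v ht, eval_linePoly hpK, mul_comm]
  obtain ⟨v₀, hv₀⟩ := hne
  obtain ⟨m, hm, -⟩ := (key v₀).resolve_left fun h => hv₀ h.1
  refine ⟨m, MvPolynomial.homogeneousComponent m p, NNReal.coe_injective (by simpa using hm.symm),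
    MvPolynomial.homogeneousComponent_isHomogeneous m p, fun v => ?_⟩
  have hmK : m ≤ K := by exact_mod_cast hm.trans_le hK
  rw [← coeff_linePoly hmK]
  rcases key v with ⟨h1, h2⟩ | ⟨m', hm', h2⟩
  · simp [h1, h2]
  · have : m' = m := by exact_mod_cast hm'.trans hm.symm
    rw [h2, this]
    simp

end Order

/-! ### Partial derivatives of germs -/

section Derivation

variable {n : ℕ}

/-- The partial derivative as a derivation of the algebra of smooth germs. -/
def partialDerivation (i : Fin n) : Derivation ℝ (SmoothGerm n) (SmoothGerm n) :=
  Derivation.mk'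
    { toFun := partialDeriv i
      map_add' := fun φ ψ => by
        obtain ⟨F, hF, rfl⟩ := exists_germOf_eq φ
        obtain ⟨G, hG, rfl⟩ := exists_germOf_eq ψ
        refine Subtype.ext (Germ.coe_eq.2 (Eventually.of_forall fun x => ?_))
        change fderiv ℝ (F + G) x _ = fderiv ℝ F x _ + fderiv ℝ G x _
        rw [fderiv_add (hF.differentiable (by simp) x) (hG.differentiable (by simp) x)]
        rfl
      map_smul' := fun c φ => by
        obtain ⟨F, hF, rfl⟩ := exists_germOf_eq φ
        refine Subtype.ext (Germ.coe_eq.2 (Eventually.of_forall fun x => ?_))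
        change fderiv ℝ (c • F) x _ = c • fderiv ℝ F x _
        rw [fderiv_const_smul (hF.differentiable (by simp) x)]
        rfl }
    fun φ ψ => by
      obtain ⟨F, hF, rfl⟩ := exists_germOf_eq φ
      obtain ⟨G, hG, rfl⟩ := exists_germOf_eq ψ
      refine Subtype.ext (Germ.coe_eq.2 (Eventually.of_forall fun x => ?_))
      change fderiv ℝ (F * G) x _ = F x * fderiv ℝ G x _ + G x * fderiv ℝ F x _
      rw [fderiv_mul (hF.differentiable (by simp) x) (hG.differentiable (by simp) x)]
      rfl

theorem partialDerivation_coord (i j : Fin n) :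
    partialDerivation i (coord j) = if i = j then 1 else 0 := by
  have h : partialDerivation i (coord j) = algebraMap ℝ (SmoothGerm n) (if i = j then 1 else 0) := by
    refine Subtype.ext ?_
    have h1 := coe_aeval_coord (n := n) (MvPolynomial.C (if i = j then 1 else 0))
    rw [MvPolynomial.aeval_C] at h1
    rw [h1]
    refine Germ.coe_eq.2 (Eventually.of_forall fun x => ?_)
    have h2 : HasFDerivAt (fun x : Eucl n => x j)
        (EuclideanSpace.proj j : Eucl n →L[ℝ] ℝ) x :=
      (EuclideanSpace.proj j : Eucl n →L[ℝ] ℝ).hasFDerivAt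
    change fderiv ℝ (fun x : Eucl n => x j) x (EuclideanSpace.single i 1) = _
    rw [h2.fderiv]
    simp [eq_comm]
  rw [h]
  split_ifs <;> simp

theorem partialDerivation_aeval (i : Fin n) (p : MvPolynomial (Fin n) ℝ) :
    partialDerivation i (MvPolynomial.aeval coord p) =
      MvPolynomial.aeval coord (MvPolynomial.pderiv i p) := by
  induction p using MvPolynomial.induction_on with
  | C a => simp
  | add p q hp hq => simp [hp, hq]
  | mul_X p j hp =>
    rw [map_mul, Derivation.leibniz, hp, MvPolynomial.aeval_X, partialDerivation_coord,
      Derivation.leibniz, MvPolynomial.pderiv_X, map_add, smul_eq_mul, smul_eq_mul, smul_eq_mul,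
      smul_eq_mul, map_mul, map_mul, MvPolynomial.aeval_X, Pi.single_apply]
    simp only [eq_comm (a := j)]
    split_ifs <;> simp

/-- By the Leibniz rule a derivation lowers the 𝔪-adic order by at most one; this transfers f ≡ P to
the partial derivatives. -/
theorem derivation_mem_pow {E : Type*} [CommRing E] [Algebra ℝ E] (D : Derivation ℝ E E)
    (I : Ideal E) (k : ℕ) : ∀ φ ∈ I ^ (k + 1), D φ ∈ I ^ k := by
  induction k with
  | zero => simp
  | succ k ih =>
    intro φ hφ
    rw [pow_succ] at hφ
    refine Submodule.mul_induction_on hφ (fun a ha b hb => ?_) fun a b ha hb => ?_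
    · rw [Derivation.leibniz, smul_eq_mul, smul_eq_mul]
      refine Ideal.add_mem _ (Ideal.mul_mem_right _ _ ha) ?_
      rw [pow_succ']
      exact Ideal.mul_mem_mul hb (ih a ha)
    · rw [map_add]
      exact Ideal.add_mem _ ha hb

end Derivation

/-! ### Initial parts, order and the Milnor number -/

section Main

open Asymptotics

variable {n : ℕ}

theorem jacobianIdeal_eq (f : SmoothGerm n) :
    jacobianIdeal f = famIdeal fun i => partialDerivation i f := rfl

/-- The order of a germ with leading form `P` of degree `m`. -/
theorem ord_eq {f : SmoothGerm n} {m : ℕ} (hf : f.1.value = 0) {F : Eucl n → ℝ}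
    (hF : (F : Germ (𝓝 (0 : Eucl n)) ℝ) = f.1) {P : MvPolynomial (Fin n) ℝ}
    (hP : P.IsHomogeneous m) (hne : P ≠ 0)
    (hm : m ≠ 0) (ho : (fun x => F x - MvPolynomial.eval x P) =o[𝓝 0] fun x => ‖x‖ ^ m) :
    ord f = m := by
  have hlim : ∀ {F' : Eucl n → ℝ}, (F' : Germ (𝓝 (0 : Eucl n)) ℝ) = f.1 → ∀ v : Eucl n,
      Tendsto (fun t : ℝ => F' (t • v) / t ^ (m : ℝ)) (𝓝[>] 0) (𝓝 (MvPolynomial.eval v P)) := by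
    intro F' hF' v
    have h1 := (isLittleO_line ho v).tendsto_div_nhds_zero.add_const (MvPolynomial.eval v P)
    rw [zero_add] at h1
    refine h1.congr' ?_
    have h2 : ∀ᶠ t : ℝ in 𝓝[>] 0, F (t • v) = F' (t • v) :=
      (tendsto_smul_nhdsGT v).eventually (Germ.coe_eq.1 (hF.trans hF'.symm))
    filter_upwards [h2, self_mem_nhdsWithin] with t ht ht0
    have ht0 : t ^ m ≠ 0 := pow_ne_zero _ (ne_of_gt ht0)
    rw [← ht, eval_smul_of_isHomogeneous hP, Real.rpow_natCast]
    field_simp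
    ring
  obtain ⟨v₀, hv₀⟩ : ∃ v : Eucl n, MvPolynomial.eval v P ≠ 0 := by
    by_contra! h
    exact hne (mvPolynomial_eq_of_eval fun v => by simpa using h v)
  have hv₀0 : v₀ ≠ 0 := by
    rintro rfl
    apply hv₀
    have := eval_smul_of_isHomogeneous hP 0 (0 : Eucl n)
    rwa [zero_smul, zero_pow hm, zero_mul] at this
  rw [ord, if_neg (not_not.2 hf)]
  apply le_antisymm
  · have hord : HasOrder F (m : ℝ≥0) :=
      ⟨fun v _ => ⟨MvPolynomial.eval v P, by simpa using hlim hF v⟩,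
        v₀, hv₀0, _, hv₀, by simpa using hlim hF v₀⟩
    exact (iInf₂_le (m : ℝ≥0) ⟨F, hF, hord⟩).trans (by simp)
  · refine le_iInf₂ fun α hα => ?_
    obtain ⟨F', hF', -, v, hv, L, hL, hFL⟩ := hα
    by_contra! hlt
    have hlt' : (α : ℝ) < m := by
      have : α < (m : ℝ≥0) := by exact_mod_cast hlt
      exact_mod_cast this
    have h1 : Tendsto (fun t : ℝ => t ^ ((m : ℝ) - α)) (𝓝[>] 0) (𝓝 0) := by
      have := (Real.continuousAt_rpow_const (0 : ℝ) ((m : ℝ) - α) (Or.inr (by linarith))).tendsto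
      rw [Real.zero_rpow (by linarith)] at this
      exact this.mono_left nhdsWithin_le_nhds
    have h2 := (hlim hF' v).mul h1
    rw [mul_zero] at h2
    refine hL (tendsto_nhds_unique hFL (h2.congr' ?_))
    filter_upwards [self_mem_nhdsWithin] with t ht
    have ht : 0 < t := ht
    rw [Real.rpow_sub ht]
    have := (Real.rpow_pos_of_pos ht (m : ℝ)).ne'
    have := (Real.rpow_pos_of_pos ht (α : ℝ)).ne'
    field_simp

/-- An initial part is the germ of a form `P` of positive degree `m`, and `f` agrees with `P` up to
terms of higher order. -/
theorem IsInitialPart.exists_form {f g : SmoothGerm n} (hf : f.1.value = 0)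
    (hg : IsInitialPart f g) :
    n ≠ 0 ∧ ∃ (m : ℕ) (P : MvPolynomial (Fin n) ℝ) (F : Eucl n → ℝ), m ≠ 0 ∧ P ≠ 0 ∧
      P.IsHomogeneous m ∧ g = MvPolynomial.aeval coord P ∧
      (F : Germ (𝓝 (0 : Eucl n)) ℝ) = f.1 ∧
      ((fun x => F x - MvPolynomial.eval x P) =o[𝓝 0] fun x => ‖x‖ ^ m) ∧
      f - MvPolynomial.aeval coord P ∈ famIdeal (coord (n := n)) ^ (m + 1) := by
  obtain ⟨α, F, G, hF, hG, hhom, hnt, hlim⟩ := hg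
  -- For n = 0 the punctured neighbourhood is empty, every limit holds trivially, and no initial
  -- part exists.
  have hn : n ≠ 0 := by
    rintro rfl
    refine hnt ?_
    have h : ({0}ᶜ : Set (Eucl 0)) = ∅ := by
      ext x
      simp [Subsingleton.elim x 0]
    rw [h, nhdsWithin_empty]
    exact tendsto_bot
  have hGne : ∃ v, G v ≠ 0 := by
    by_contra! h
    refine hnt ?_
    simp only [h, zero_div]
    exact tendsto_const_nhds
  have hF0 : F 0 = 0 := by rw [← hF] at hf; exact hf
  obtain ⟨m, P, rfl, hP, hGP⟩ := exists_form_of_homogeneous hG hhom hGne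
  have hPne : P ≠ 0 := by
    rintro rfl
    obtain ⟨v, hv⟩ := hGne
    exact hv (by simp [hGP v])
  -- If m = 0, then G = F - o(1) tends to F(0) = 0, against the nonvanishing condition on G.
  have hm : m ≠ 0 := by
    rintro rfl
    have hFc : Tendsto F (𝓝[≠] 0) (𝓝 0) := by
      obtain ⟨F₀, hF₀, hF₀f⟩ := exists_germOf_eq f
      have h1 : F₀ =ᶠ[𝓝 0] F := Germ.coe_eq.1 ((congrArg Subtype.val hF₀f).trans hF.symm)
      have h2 : Tendsto F₀ (𝓝 0) (𝓝 (F₀ 0)) := hF₀.continuous.tendsto 0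
      rw [h1.eq_of_nhds, hF0] at h2
      exact (h2.congr' h1).mono_left nhdsWithin_le_nhds
    refine hnt ?_
    have h3 := hFc.sub hlim
    simpa using h3
  have ho : (fun x => F x - MvPolynomial.eval x P) =o[𝓝 0] fun x => ‖x‖ ^ m := by
    have hG0 : MvPolynomial.eval (0 : Eucl n) P = 0 := by
      have := eval_smul_of_isHomogeneous hP 0 (0 : Eucl n)
      rwa [zero_smul, zero_pow hm, zero_mul] at this
    have h1 : (fun x => F x - MvPolynomial.eval x P) =o[𝓝[≠] 0] fun x => ‖x‖ ^ m := by
      refine (isLittleO_iff_tendsto' ?_).2 ?_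
      · filter_upwards [self_mem_nhdsWithin] with x hx h0
        exact absurd h0 (pow_ne_zero _ (norm_ne_zero_iff.2 hx))
      · refine hlim.congr fun x => ?_
        rw [← hGP x]
        simp
    refine isLittleO_iff.2 fun c hc => ?_
    filter_upwards [eventually_nhdsWithin_iff.1 (isLittleO_iff.1 h1 hc)] with x hx
    rcases eq_or_ne x 0 with rfl | hx0
    · rw [hF0, hG0]
      simp only [sub_zero, norm_zero]
      positivity
    · exact hx hx0
  refine ⟨hn, m, P, F, hm, hPne, hP, ?_, hF, ho, ?_⟩
  · refine Subtype.ext ?_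
    rw [coe_aeval_coord, ← hG]
    exact congrArg _ (funext hGP)
  -- The analytic estimate becomes an ideal membership because the Taylor polynomial q of degree ≤ m
  -- must equal P: their difference is o(‖x‖^m).
  · obtain ⟨q, hqm, hq, hqo⟩ := exists_taylor hF m
    have h1 : q - P = 0 := by
      refine mvPolynomial_eq_zero_of_isLittleO (K := m)
        ((MvPolynomial.totalDegree_sub _ _).trans (max_le hqm hP.totalDegree_le)) ?_
      refine (ho.sub hqo).congr_left fun x => ?_
      rw [map_sub]; ring
    rwa [sub_eq_zero.1 h1] at hq

end Main

end RealMilnor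

end

theorem proposition4p2 (n : ℕ) (f g : RealMilnor.SmoothGerm n) (hf : f.1.value = 0)
    (hg : RealMilnor.IsInitialPart f g) (hiso : RealMilnor.AlgebraicallyIsolated g) :
    ∃ m : ℕ, 1 ≤ m ∧ RealMilnor.ord f = (m : ENNReal) ∧
      RealMilnor.milnorNumber f = (((m - 1) ^ n : ℕ) : ℕ∞) := by
  open RealMilnor in
  obtain ⟨hn, m, P, F, hm, hPne, hP, rfl, hF, ho, hfP⟩ := hg.exists_form hf
  refine ⟨m, Nat.one_le_iff_ne_zero.2 hm, ord_eq hf hF hP hPne hm ho, ?_⟩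
  have hfin : Module.Finite ℝ (SmoothGerm n ⧸
      famIdeal fun i => MvPolynomial.aeval coord (MvPolynomial.pderiv i P)) := by
    have hJ : jacobianIdeal (MvPolynomial.aeval coord P) =
        famIdeal fun i => MvPolynomial.aeval coord (MvPolynomial.pderiv i P) :=
      congrArg famIdeal (funext fun i => partialDerivation_aeval i P)
    rw [AlgebraicallyIsolated, milnorNumber, Cardinal.toENat_lt_top, hJ] at hiso
    have := Module.Free.of_divisionRing ℝ (SmoothGerm n ⧸
      famIdeal fun i => MvPolynomial.aeval coord (MvPolynomial.pderiv i P))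
    exact Module.rank_lt_aleph0_iff.1 hiso
  -- Applied with d = m - 1: differentiating f - P ∈ 𝔪^(m+1) lands in 𝔪^m, which is 𝔪^(d+1) since m
  -- ≥ 1.
  obtain ⟨hfinF, hrank⟩ := isCoordinates_coord.finrank_quotient_eq_pow hn
    (F := fun i => partialDerivation i f) (fun i => hP.pderiv (i := i)) (fun i => by
      rw [← partialDerivation_aeval, ← map_sub, Nat.sub_add_cancel (Nat.one_le_iff_ne_zero.2 hm)]
      exact derivation_mem_pow _ _ _ _ hfP) hfin
  rw [milnorNumber, jacobianIdeal_eq, ← Module.finrank_eq_rank, hrank, Cardinal.toENat_nat]
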